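/- Let $(X,\mathcal B,\mu)$ be a standard non-atomic probability space, and let $\mathrm{Aut}=\mathrm{Aut}(X,\mathcal B,\mu)$ be the group of its invertible measure-preserving transformations, where transformations that coincide almost everywhere are identified. Equip $\mathrm{Aut}$ with the Halmos metric $$\rho(S,T)=\sum_{i\ge 0}2^{-i}\bigl(\mu(SA_i\,\triangle\, TA_i)+\mu(S^{-1}A_i\,\triangle\, T^{-1}A_i)\bigr),$$ where $(A_i)_{i\ge 0}$ is any sequence of measurable sets that is dense in $\mathcal B$ (for the pseudometric $\mu(A\triangle B)$). A set of transformations is called generic if it contains a dense $G_\delta$ subset of $(\mathrm{Aut},\rho)$. Denote the operator $f\mapsto f\circ T$ on the complex space $L_2(X,\mathcal B,\mu)$ again by $T$, and let $\Theta$ be the orthogonal projection of $L_2(X,\mathcal B,\mu)$ onto the constants. An admissible function is an expression $$Q(T)=a\,\Theta+\sum_{i\in\mathbb Z}a_iT^i,\qquad a\ge 0,\ a_i\ge 0,\ \sum_{i\in\mathbb Z} a_i=1-a .$$ Let $M\subset\mathbb N$ be an infinite set and let $Q,R$ be admissible functions. Then: (i) the set of $T\in\mathrm{Aut}$ for which there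 is an infinite subset $M'\subset M$ (depending on $T$) such that $T^m\to R(T)$ in the weak operator topology as $m\to\infty$, $m\in M'$, is generic; (ii) the set of $T\in\mathrm{Aut}$ such that $T^m\to Q(T)$ in the weak operator topology as $m\to\infty$, $m\in M$, is of first category in $(\mathrm{Aut},\rho)$. In particular, each of the following sets is generic: the set of weakly mixing transformations, i.e. those $T$ with $\frac1N\sum_{n=0}^{N-1}|\langle T^nf,g\rangle-\langle\Theta f,g\rangle|\to0$ for all $f,g\in L_2$; the set of transformations that are not mixing, i.e. for which $T^m\to\Theta$ weakly as $m\to\infty$ fails; and, for every $\kappa\in[0,1]$, the set of $\kappa$-mixing transformations, i.e. those $T$ for which $T^m\to\kappa\Theta+(1-\kappa)I$ weakly along some infinite set of positive integers $m\to\infty$. -/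

import Mathlib

open MeasureTheory Filter Topology
open scoped ENNReal symmDiff

noncomputable section

namespace WeakLimits

variable {X : Type*} [MeasurableSpace X]

/-- The group of bimeasurable bijections of `X` that preserve `μ`. -/
def mpPerm (μ : Measure X) : Subgroup (Equiv.Perm X) where
  carrier := {e | MeasurePreserving e μ μ ∧ MeasurePreserving e.symm μ μ}
  one_mem' := ⟨MeasurePreserving.id μ, MeasurePreserving.id μ⟩
  mul_mem' := fun ha hb => ⟨ha.1.comp hb.1, hb.2.comp ha.2⟩
  inv_mem' := fun ha => ⟨ha.2, ha.1⟩

theorem mpPerm.measurePreserving {μ : Measure X} (e : mpPerm μ) :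
    MeasurePreserving (e : Equiv.Perm X) μ μ := e.2.1

/-- The transformations that coincide with the identity almost everywhere. -/
def trivialPerm (μ : Measure X) : Subgroup (mpPerm μ) where
  carrier := {e | ∀ᵐ x ∂μ, (e : Equiv.Perm X) x = x}
  one_mem' := by
    change ∀ᵐ x ∂μ, ((1 : mpPerm μ) : Equiv.Perm X) x = x
    exact Eventually.of_forall fun _ => rfl
  mul_mem' := by
    intro a b ha hb
    change ∀ᵐ x ∂μ, (a : Equiv.Perm X) ((b : Equiv.Perm X) x) = x
    filter_upwards [b.2.1.quasiMeasurePreserving.ae ha, hb] with x h1 h2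
    exact h1.trans h2
  inv_mem' := by
    intro a ha
    change ∀ᵐ x ∂μ, (a : Equiv.Perm X).symm x = x
    filter_upwards [a.2.2.quasiMeasurePreserving.ae ha] with x hx
    have h : (a : Equiv.Perm X) ((a : Equiv.Perm X).symm x) = x := Equiv.apply_symm_apply _ x
    exact hx.symm.trans h

instance (μ : Measure X) : (trivialPerm μ).Normal where
  conj_mem := by
    intro n hn g
    change ∀ᵐ x ∂μ, (g : Equiv.Perm X) ((n : Equiv.Perm X) ((g : Equiv.Perm X).symm x)) = x
    filter_upwards [g.2.2.quasiMeasurePreserving.ae hn] with x hx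
    rw [hx]
    exact Equiv.apply_symm_apply _ x

/-- The group `Aut(X, μ)`: invertible measure-preserving transformations, where two
transformations that coincide almost everywhere are identified. -/
abbrev MPAut (μ : Measure X) : Type _ := mpPerm μ ⧸ trivialPerm μ

theorem ae_eq_of_rel {μ : Measure X} {S T : mpPerm μ}
    (h : QuotientGroup.leftRel (trivialPerm μ) S T) :
    ∀ᵐ x ∂μ, (S : Equiv.Perm X) x = (T : Equiv.Perm X) x := by
  have h' : ∀ᵐ x ∂μ, (S : Equiv.Perm X).symm ((T : Equiv.Perm X) x) = x :=
    QuotientGroup.leftRel_apply.1 h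
  filter_upwards [h'] with x hx
  exact ((Equiv.symm_apply_eq _).1 hx).symm

theorem rel_of_ae_eq {μ : Measure X} {S T : mpPerm μ}
    (h : ∀ᵐ x ∂μ, (S : Equiv.Perm X) x = (T : Equiv.Perm X) x) :
    QuotientGroup.leftRel (trivialPerm μ) S T := by
  refine QuotientGroup.leftRel_apply.2 ?_
  change ∀ᵐ x ∂μ, (S : Equiv.Perm X).symm ((T : Equiv.Perm X) x) = x
  filter_upwards [h] with x hx
  exact (Equiv.symm_apply_eq _).2 hx.symm

theorem ae_symm_eq {μ : Measure X} {S T : mpPerm μ}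
    (h : ∀ᵐ x ∂μ, (S : Equiv.Perm X) x = (T : Equiv.Perm X) x) :
    ∀ᵐ x ∂μ, (S : Equiv.Perm X).symm x = (T : Equiv.Perm X).symm x := by
  filter_upwards [T.2.2.quasiMeasurePreserving.ae h] with x hx
  rw [Equiv.symm_apply_eq, hx, Equiv.apply_symm_apply]

theorem image_ae_eq {μ : Measure X} {S T : mpPerm μ}
    (h : ∀ᵐ x ∂μ, (S : Equiv.Perm X) x = (T : Equiv.Perm X) x) (A : Set X) :
    ((S : Equiv.Perm X) '' A : Set X) =ᵐ[μ] ((T : Equiv.Perm X) '' A : Set X) := by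
  rw [Equiv.image_eq_preimage_symm, Equiv.image_eq_preimage_symm]
  filter_upwards [ae_symm_eq h] with x hx
  change A ((S : Equiv.Perm X).symm x) = A ((T : Equiv.Perm X).symm x)
  rw [hx]

/-- The number `μ(SA Δ TA)`. -/
def imageDist {μ : Measure X} (A : Set X) (S T : MPAut μ) : ℝ :=
  Quotient.liftOn₂' S T
    (fun S T : mpPerm μ => μ.real (((S : Equiv.Perm X) '' A) ∆ ((T : Equiv.Perm X) '' A)))
    (fun _ _ _ _ hS hT => congrArg ENNReal.toReal (measure_congr
      ((image_ae_eq (ae_eq_of_rel hS) A).symmDiff (image_ae_eq (ae_eq_of_rel hT) A))))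

/-- A sequence of measurable sets that is dense in the measure algebra of `μ`. -/
structure DenseFamily (μ : Measure X) where
  set : ℕ → Set X
  measurableSet : ∀ i, MeasurableSet (set i)
  dense : ∀ B : Set X, MeasurableSet B → ∀ ε : ℝ, 0 < ε → ∃ i, μ.real (set i ∆ B) < ε

section Metric

variable {μ : Measure X}

theorem imageDist_nonneg (A : Set X) (S T : MPAut μ) : 0 ≤ imageDist A S T := by
  induction S using Quotient.inductionOn'
  induction T using Quotient.inductionOn'
  exact measureReal_nonneg

theorem imageDist_self (A : Set X) (T : MPAut μ) : imageDist A T T = 0 := by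
  induction T using Quotient.inductionOn' with | h T => ?_
  change μ.real (((T : Equiv.Perm X) '' A) ∆ ((T : Equiv.Perm X) '' A)) = 0
  simp

theorem imageDist_comm (A : Set X) (S T : MPAut μ) : imageDist A S T = imageDist A T S := by
  induction S using Quotient.inductionOn' with | h S => ?_
  induction T using Quotient.inductionOn' with | h T => ?_
  change μ.real (((S : Equiv.Perm X) '' A) ∆ ((T : Equiv.Perm X) '' A)) =
    μ.real (((T : Equiv.Perm X) '' A) ∆ ((S : Equiv.Perm X) '' A))
  rw [symmDiff_comm]

variable [IsProbabilityMeasure μ]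

theorem imageDist_le_one (A : Set X) (S T : MPAut μ) : imageDist A S T ≤ 1 := by
  induction S using Quotient.inductionOn'
  induction T using Quotient.inductionOn'
  exact measureReal_le_one

theorem imageDist_triangle (A : Set X) (S T U : MPAut μ) :
    imageDist A S U ≤ imageDist A S T + imageDist A T U := by
  induction S using Quotient.inductionOn'
  induction T using Quotient.inductionOn'
  induction U using Quotient.inductionOn'
  exact measureReal_symmDiff_le _

/-- The Halmos distance
`ρ(S, T) = ∑ᵢ 2⁻ⁱ (μ(SAᵢ Δ TAᵢ) + μ(S⁻¹Aᵢ Δ T⁻¹Aᵢ))`. -/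
def halmosDist (D : DenseFamily μ) (S T : MPAut μ) : ℝ :=
  ∑' i : ℕ, (1 / 2 : ℝ) ^ i * (imageDist (D.set i) S T + imageDist (D.set i) S⁻¹ T⁻¹)

theorem summable_halmosDist (D : DenseFamily μ) (S T : MPAut μ) :
    Summable fun i : ℕ =>
      (1 / 2 : ℝ) ^ i * (imageDist (D.set i) S T + imageDist (D.set i) S⁻¹ T⁻¹) := by
  refine Summable.of_nonneg_of_le (fun i => ?_) (fun i => ?_)
    (summable_geometric_two.mul_right 2)
  · have := imageDist_nonneg (D.set i) S T
    have := imageDist_nonneg (D.set i) S⁻¹ T⁻¹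
    positivity
  · have h1 := imageDist_le_one (D.set i) S T
    have h2 := imageDist_le_one (D.set i) S⁻¹ T⁻¹
    gcongr
    linarith

theorem eq_of_imageDist_eq_zero [StandardBorelSpace X] (D : DenseFamily μ) (S T : MPAut μ)
    (h : ∀ i, imageDist (D.set i) S T = 0) : S = T := by
  induction S using Quotient.inductionOn' with | h S => ?_
  induction T using Quotient.inductionOn' with | h T => ?_
  refine Quotient.sound' (rel_of_ae_eq ?_)
  have key : ∀ B : Set X, MeasurableSet B →
      ((S : Equiv.Perm X) '' B : Set X) =ᵐ[μ] ((T : Equiv.Perm X) '' B : Set X) := by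
    intro B hB
    rw [← measure_symmDiff_eq_zero_iff, ← measureReal_eq_zero_iff]
    refine le_antisymm (le_of_forall_pos_le_add fun ε hε => ?_) measureReal_nonneg
    obtain ⟨i, hi⟩ := D.dense B hB (ε / 2) (half_pos hε)
    have tr : ∀ R : mpPerm μ,
        μ.real (((R : Equiv.Perm X) '' D.set i) ∆ ((R : Equiv.Perm X) '' B)) < ε / 2 := by
      intro R
      rw [Equiv.image_eq_preimage_symm, Equiv.image_eq_preimage_symm, ← Set.preimage_symmDiff,
        measureReal_def,
        R.2.2.measure_preimage ((D.measurableSet i).symmDiff hB).nullMeasurableSet]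
      exact hi
    have h0 : μ.real (((S : Equiv.Perm X) '' D.set i) ∆ ((T : Equiv.Perm X) '' D.set i)) = 0 := h i
    have h1 := tr S
    have h2 := tr T
    rw [symmDiff_comm] at h1
    have t1 := measureReal_symmDiff_le (μ := μ) (s := (S : Equiv.Perm X) '' B)
      (t := (S : Equiv.Perm X) '' D.set i) ((T : Equiv.Perm X) '' B)
    have t2 := measureReal_symmDiff_le (μ := μ) (s := (S : Equiv.Perm X) '' D.set i)
      (t := (T : Equiv.Perm X) '' D.set i) ((T : Equiv.Perm X) '' B)
    linarith
  have hs : ∀ᵐ x ∂μ, (S : Equiv.Perm X).symm x = (T : Equiv.Perm X).symm x := by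
    refine Filter.EventuallyEq.of_forall_separating_preimage (l := ae μ) MeasurableSet
      fun B hB => ?_
    have := key B hB
    rwa [Equiv.image_eq_preimage_symm, Equiv.image_eq_preimage_symm] at this
  filter_upwards [T.2.1.quasiMeasurePreserving.ae hs] with x hx
  rw [Equiv.symm_apply_apply, Equiv.symm_apply_eq] at hx
  exact hx.symm

/-- The metric space `(Aut(X, μ), ρ)`. -/
abbrev halmosMetric [StandardBorelSpace X] (D : DenseFamily μ) : MetricSpace (MPAut μ) where
  dist := halmosDist D
  dist_self T := by
    simp [halmosDist, imageDist_self]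
  dist_comm S T := by
    simp [halmosDist, imageDist_comm _ S T, imageDist_comm _ S⁻¹ T⁻¹]
  dist_triangle S T U := by
    rw [halmosDist, halmosDist, halmosDist,
      ← (summable_halmosDist D S T).tsum_add (summable_halmosDist D T U)]
    refine (summable_halmosDist D S U).tsum_le_tsum (fun i => ?_)
      ((summable_halmosDist D S T).add (summable_halmosDist D T U))
    rw [← mul_add]
    have h1 := imageDist_triangle (D.set i) S T U
    have h2 := imageDist_triangle (D.set i) S⁻¹ T⁻¹ U⁻¹
    refine mul_le_mul_of_nonneg_left ?_ (by positivity)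
    linarith
  eq_of_dist_eq_zero := by
    intro S T h
    replace h : halmosDist D S T = 0 := h
    refine eq_of_imageDist_eq_zero D S T fun i => ?_
    have hn : ∀ j, 0 ≤ (1 / 2 : ℝ) ^ j *
        (imageDist (D.set j) S T + imageDist (D.set j) S⁻¹ T⁻¹) := fun j => by
      have := imageDist_nonneg (D.set j) S T
      have := imageDist_nonneg (D.set j) S⁻¹ T⁻¹
      positivity
    have hi := congrFun (((summable_halmosDist D S T).hasSum_iff.2 h |>
      (hasSum_zero_iff_of_nonneg hn).1)) i
    have h1 := imageDist_nonneg (D.set i) S T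
    have h2 := imageDist_nonneg (D.set i) S⁻¹ T⁻¹
    have h3 : imageDist (D.set i) S T + imageDist (D.set i) S⁻¹ T⁻¹ = 0 :=
      (mul_eq_zero.1 hi).resolve_left (by positivity)
    linarith

/-- A set of transformations is generic if it contains a dense `G_δ` subset of
`(Aut(X, μ), ρ)`. -/
def IsGeneric [StandardBorelSpace X] (D : DenseFamily μ) (s : Set (MPAut μ)) : Prop :=
  letI := halmosMetric D
  ∃ W ⊆ s, IsGδ W ∧ Dense W

/-- A set of transformations of first category (meagre) in `(Aut(X, μ), ρ)`. -/
def IsFirstCategory [StandardBorelSpace X] (D : DenseFamily μ) (s : Set (MPAut μ)) : Prop :=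
  letI := halmosMetric D
  IsMeagre s

end Metric

/-- The complex Hilbert space `L₂(X, μ)`. -/
abbrev L2 (μ : Measure X) : Type _ := Lp ℂ 2 μ

/-- The operator on `L₂(X, μ)` induced by `T`, namely `f ↦ f ∘ T`. -/
def koopman {μ : Measure X} (T : MPAut μ) : L2 μ →L[ℂ] L2 μ :=
  Quotient.liftOn' T
    (fun T : mpPerm μ =>
      (Lp.compMeasurePreservingₗᵢ ℂ (T : Equiv.Perm X)
        (mpPerm.measurePreserving T)).toContinuousLinearMap)
    (by
      intro S T h
      ext1 f
      refine Lp.ext ?_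
      change Lp.compMeasurePreserving _ (mpPerm.measurePreserving S) f =ᵐ[μ]
        Lp.compMeasurePreserving _ (mpPerm.measurePreserving T) f
      filter_upwards [Lp.coeFn_compMeasurePreserving f (mpPerm.measurePreserving S),
        Lp.coeFn_compMeasurePreserving f (mpPerm.measurePreserving T), ae_eq_of_rel h]
        with x h1 h2 h3
      rw [h1, h2, Function.comp_apply, Function.comp_apply, h3])

/-- `Θ`, the orthogonal projection of `L₂(X, μ)` onto the constants. -/
def meanProj (μ : Measure X) [IsProbabilityMeasure μ] : L2 μ →L[ℂ] L2 μ :=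
  (Submodule.span ℂ {Lp.const 2 μ (1 : ℂ)}).starProjection

/-- The coefficients of an admissible function
`Q(T) = a Θ + ∑ᵢ aᵢ Tⁱ`, `a, aᵢ ≥ 0`, `∑ᵢ aᵢ = 1 - a`, `i ∈ ℤ`. -/
structure Admissible where
  a : ℝ
  coeff : ℤ → ℝ
  a_nonneg : 0 ≤ a
  coeff_nonneg : ∀ i, 0 ≤ coeff i
  hasSum : HasSum coeff (1 - a)

variable {μ : Measure X} [IsProbabilityMeasure μ]

/-- The operator `Q(T)`; the series converges absolutely in the operator norm. -/
def Admissible.eval (Q : Admissible) (T : MPAut μ) : L2 μ →L[ℂ] L2 μ :=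
  (Q.a : ℂ) • meanProj μ + ∑' i : ℤ, (Q.coeff i : ℂ) • koopman (T ^ i)

/-- `T^m → V` in the weak operator topology, as `m → ∞`, `m ∈ M`. -/
def WeakLimitAlong (M : Set ℕ) (T : MPAut μ) (V : L2 μ →L[ℂ] L2 μ) : Prop :=
  Tendsto (fun m : ℕ => ContinuousLinearMapWOT.ofCLM (koopman (T ^ m))) (atTop ⊓ 𝓟 M)
    (𝓝 (ContinuousLinearMapWOT.ofCLM V))

/-- Mixing: `T^m → Θ` weakly as `m → ∞`. -/
def IsMixing (T : MPAut μ) : Prop := WeakLimitAlong Set.univ T (meanProj μ)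

/-- Weak mixing: correlations tend to zero in the sense of Cesàro,
`(1/N) ∑_{n<N} |⟨Tⁿf, g⟩ - ⟨Θf, g⟩| → 0` for all `f, g ∈ L₂(X, μ)`. -/
def IsWeakMixing (T : MPAut μ) : Prop :=
  ∀ f g : L2 μ, Tendsto
    (fun N : ℕ => (N : ℝ)⁻¹ * ∑ n ∈ Finset.range N,
      ‖inner ℂ (koopman (T ^ n) f) g - inner ℂ (meanProj μ f) g‖) atTop (𝓝 0)

/-- `κ`-mixing: `T^m → κ Θ + (1 - κ) I` weakly along some sequence `m → ∞`. -/
def IsKappaMixing (κ : ℝ) (T : MPAut μ) : Prop :=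
  ∃ M : Set ℕ, M.Infinite ∧
    WeakLimitAlong M T ((κ : ℂ) • meanProj μ + ((1 - κ : ℝ) : ℂ) • ContinuousLinearMap.id ℂ (L2 μ))

end WeakLimits

end

/-!
The Halmos metric induces the topology in which `T` is close to `S` when the correlations
`μ (T⁻¹ A ∩ B)` and `μ (S⁻¹ A ∩ B)` are close, and this topology is Polish. By Baire's theorem it
is therefore enough to find, close to any `T` and for all large `m`, some `U` for which the
correlations of `U ^ m` are close to those of `R(T)`. Following the orbits of `T` along a cycle of
length `m - j` creates a defect only at the seam, and the `m`-th power is close to `T ^ j`. If the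
two halves of a cycle of length `2 * m` follow the orbits of independent points instead, then time
`m` is independent of time `0`, which is the limit `Θ`; disjoint unions of such cycles give convex
combinations. These models live on other non-atomic spaces and are transported to `X` by the
isomorphism theorem.

Applied to `Θ` and to `I`, this shows that a generic `T` has two different weak limits along `M`, so
convergence along `M` is of first category. Weak mixing follows from `T ^ m → Θ` along one
sequence: the translates of a mean-zero `g` then contain arbitrarily long almost orthogonal
families, and a Bessel-type inequality makes `⟪T ^ n f, g⟫` small on average.
-/

noncomputable section

namespace WeakLimits

section Correlation

variable {X : Type*} [MeasurableSpace X] {μ : Measure X}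

theorem mpPerm.measurable (T : mpPerm μ) : Measurable (T : Equiv.Perm X) := T.2.1.measurable

theorem mpPerm.measurableSet_image (T : mpPerm μ) {A : Set X} (hA : MeasurableSet A) :
    MeasurableSet ((T : Equiv.Perm X) '' A) := by
  rw [Equiv.image_eq_preimage_symm]
  exact T.2.2.measurable hA

theorem mpPerm.measureReal_preimage (T : mpPerm μ) {A : Set X} (hA : MeasurableSet A) :
    μ.real ((T : Equiv.Perm X) ⁻¹' A) = μ.real A :=
  T.2.1.measureReal_preimage hA.nullMeasurableSet

theorem mpPerm.measureReal_image (T : mpPerm μ) {A : Set X} (hA : MeasurableSet A) :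
    μ.real ((T : Equiv.Perm X) '' A) = μ.real A := by
  rw [Equiv.image_eq_preimage_symm, T.2.2.measureReal_preimage hA.nullMeasurableSet]

/-- The correlation `μ(T⁻¹A ∩ B)` of the sets `A` and `B` along `T`. -/
def corr (A B : Set X) (T : MPAut μ) : ℝ :=
  Quotient.liftOn' T (fun T : mpPerm μ => μ.real ((T : Equiv.Perm X) ⁻¹' A ∩ B)) (by
    intro S T h
    refine measureReal_congr (EventuallyEq.inter ?_ .rfl)
    filter_upwards [ae_eq_of_rel h] with x hx
    exact congrArg A hx)

theorem corr_mk (A B : Set X) (T : mpPerm μ) :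
    corr A B (T : MPAut μ) = μ.real ((T : Equiv.Perm X) ⁻¹' A ∩ B) := rfl

theorem corr_mk_eq_inter_image {A B : Set X} (hA : MeasurableSet A) (hB : MeasurableSet B)
    (T : mpPerm μ) : corr A B (T : MPAut μ) = μ.real (A ∩ (T : Equiv.Perm X) '' B) := by
  rw [corr_mk, ← mpPerm.measureReal_image T ((mpPerm.measurable T hA).inter hB),
    Set.image_preimage_inter]

theorem corr_nonneg (A B : Set X) (T : MPAut μ) : 0 ≤ corr A B T := by
  induction T using QuotientGroup.induction_on
  exact measureReal_nonneg

theorem corr_le_one [IsProbabilityMeasure μ] (A B : Set X) (T : MPAut μ) : corr A B T ≤ 1 := by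
  induction T using QuotientGroup.induction_on
  exact measureReal_le_one

theorem corr_inv {A B : Set X} (hA : MeasurableSet A) (hB : MeasurableSet B) (T : MPAut μ) :
    corr A B T⁻¹ = corr B A T := by
  induction T using QuotientGroup.induction_on with | H T => ?_
  rw [← QuotientGroup.mk_inv, corr_mk_eq_inter_image hA hB, corr_mk, Set.inter_comm]
  exact congrArg (fun C => μ.real (C ∩ A)) (Equiv.image_symm_eq_preimage _ _)

theorem corr_zpow_eq_of_natCast_eq_add {A B : Set X} (hA : MeasurableSet A)
    (hB : MeasurableSet B) (T : mpPerm μ) {p q : ℕ} {j : ℤ} (h : (p : ℤ) = q + j) :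
    corr A B ((T : MPAut μ) ^ j) =
      μ.real (((T ^ p : mpPerm μ) : Equiv.Perm X) ⁻¹' A ∩
        ((T ^ q : mpPerm μ) : Equiv.Perm X) ⁻¹' B) := by
  rw [← QuotientGroup.mk_zpow, corr_mk,
    ← mpPerm.measureReal_preimage (T ^ q) ((mpPerm.measurable (T ^ j) hA).inter hB),
    Set.preimage_inter, ← Set.preimage_comp, ← Equiv.Perm.coe_mul, ← Subgroup.coe_mul,
    ← zpow_natCast T q, ← zpow_add, add_comm j, ← h, zpow_natCast]

theorem imageDist_mk (A : Set X) (S T : mpPerm μ) :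
    imageDist A (S : MPAut μ) (T : MPAut μ) =
      μ.real (((S : Equiv.Perm X) '' A) ∆ ((T : Equiv.Perm X) '' A)) := rfl

theorem imageDist_inv_mk (A : Set X) (S T : mpPerm μ) :
    imageDist A (S : MPAut μ)⁻¹ (T : MPAut μ)⁻¹ =
      μ.real (((S : Equiv.Perm X) ⁻¹' A) ∆ ((T : Equiv.Perm X) ⁻¹' A)) := by
  change μ.real (((S : Equiv.Perm X).symm '' A) ∆ ((T : Equiv.Perm X).symm '' A)) = _
  rw [Equiv.image_symm_eq_preimage, Equiv.image_symm_eq_preimage]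

theorem imageDist_mul_left {A : Set X} (hA : MeasurableSet A) (U S T : MPAut μ) :
    imageDist A (U * S) (U * T) = imageDist A S T := by
  induction U using QuotientGroup.induction_on with | H U => ?_
  induction S using QuotientGroup.induction_on with | H S => ?_
  induction T using QuotientGroup.induction_on with | H T => ?_
  simp only [← QuotientGroup.mk_mul, imageDist_mk, Subgroup.coe_mul, Equiv.Perm.coe_mul,
    Set.image_comp]
  rw [← Set.image_symmDiff (U : Equiv.Perm X).injective,
    mpPerm.measureReal_image U
      ((mpPerm.measurableSet_image S hA).symmDiff (mpPerm.measurableSet_image T hA))]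

theorem imageDist_mul_right_mk (A : Set X) (S T : MPAut μ) (U : mpPerm μ) :
    imageDist A (S * (U : MPAut μ)) (T * (U : MPAut μ)) =
      imageDist ((U : Equiv.Perm X) '' A) S T := by
  induction S using QuotientGroup.induction_on with | H S => ?_
  induction T using QuotientGroup.induction_on with | H T => ?_
  simp only [← QuotientGroup.mk_mul, imageDist_mk, Subgroup.coe_mul, Equiv.Perm.coe_mul,
    Set.image_comp]

variable [IsFiniteMeasure μ]

theorem measureReal_symmDiff_eq {A B : Set X} (hA : MeasurableSet A) (hB : MeasurableSet B) :
    μ.real (A ∆ B) = μ.real A + μ.real B - 2 * μ.real (A ∩ B) := by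
  rw [Set.symmDiff_def, measureReal_union disjoint_sdiff_sdiff (hB.diff hA)]
  have := measureReal_inter_add_sdiff (μ := μ) (s := A) hB
  have := measureReal_inter_add_sdiff (μ := μ) (s := B) hA
  rw [Set.inter_comm] at this
  linarith

theorem imageDist_mk_eq_sub_corr {A : Set X} (hA : MeasurableSet A) (S : MPAut μ) (T : mpPerm μ) :
    imageDist A S (T : MPAut μ) = 2 * μ.real A - 2 * corr ((T : Equiv.Perm X) '' A) A S := by
  induction S using QuotientGroup.induction_on with | H S => ?_
  have hT := mpPerm.measurableSet_image T hA
  rw [imageDist_mk, measureReal_symmDiff_eq (mpPerm.measurableSet_image S hA) hT,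
    mpPerm.measureReal_image S hA, mpPerm.measureReal_image T hA,
    corr_mk_eq_inter_image hT hA, Set.inter_comm]
  ring

theorem abs_corr_sub_le_imageDist {A B : Set X} (hA : MeasurableSet A) (hB : MeasurableSet B)
    (S T : MPAut μ) : |corr A B S - corr A B T| ≤ imageDist B S T := by
  induction S using QuotientGroup.induction_on with | H S => ?_
  induction T using QuotientGroup.induction_on with | H T => ?_
  have hS := mpPerm.measurableSet_image S hB
  have hT := mpPerm.measurableSet_image T hB
  rw [corr_mk_eq_inter_image hA hB, corr_mk_eq_inter_image hA hB, imageDist_mk]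
  calc |μ.real (A ∩ (S : Equiv.Perm X) '' B) - μ.real (A ∩ (T : Equiv.Perm X) '' B)|
    _ ≤ μ.real ((A ∩ (S : Equiv.Perm X) '' B) ∆ (A ∩ (T : Equiv.Perm X) '' B)) :=
      abs_measureReal_sub_le_measureReal_symmDiff (hA.inter hS).nullMeasurableSet
        (hA.inter hT).nullMeasurableSet
    _ ≤ μ.real (((S : Equiv.Perm X) '' B) ∆ ((T : Equiv.Perm X) '' B)) := by
      rw [← Set.inter_symmDiff_distrib_left]
      exact measureReal_mono Set.inter_subset_right

theorem imageDist_le_add_symmDiff {A B : Set X} (hA : MeasurableSet A) (hB : MeasurableSet B)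
    (S T : MPAut μ) : imageDist A S T ≤ imageDist B S T + 2 * μ.real (A ∆ B) := by
  induction S using QuotientGroup.induction_on with | H S => ?_
  induction T using QuotientGroup.induction_on with | H T => ?_
  have himage (V : mpPerm μ) :
      μ.real (((V : Equiv.Perm X) '' A) ∆ ((V : Equiv.Perm X) '' B)) = μ.real (A ∆ B) := by
    rw [← Set.image_symmDiff (V : Equiv.Perm X).injective,
      mpPerm.measureReal_image V (hA.symmDiff hB)]
  have hS := measureReal_symmDiff_le (μ := μ) (s := (S : Equiv.Perm X) '' A)
    (t := (S : Equiv.Perm X) '' B) ((T : Equiv.Perm X) '' A)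
  have hT := measureReal_symmDiff_le (μ := μ) (s := (S : Equiv.Perm X) '' B)
    (t := (T : Equiv.Perm X) '' B) ((T : Equiv.Perm X) '' A)
  rw [himage] at hS
  rw [symmDiff_comm ((T : Equiv.Perm X) '' B), himage] at hT
  rw [imageDist_mk, imageDist_mk]
  linarith

end Correlation

section WeakTopology

variable {X : Type*} [MeasurableSpace X] {μ : Measure X}

/-- The weak topology of `Aut(X, μ)`: the coarsest one for which all correlations
`T ↦ μ(T⁻¹A ∩ B)` of measurable sets are continuous. It is the topology of the Halmos metric of
every dense family, see `toTopologicalSpace_halmosMetric`. -/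
instance weakTopology (μ : Measure X) : TopologicalSpace (MPAut μ) :=
  .induced (fun T (p : {A : Set X // MeasurableSet A} × {B : Set X // MeasurableSet B}) =>
    corr p.1.1 p.2.1 T) inferInstance

theorem tendsto_nhds_iff_corr {ι : Type*} {l : Filter ι} {u : ι → MPAut μ} {T : MPAut μ} :
    Tendsto u l (𝓝 T) ↔ ∀ A B, MeasurableSet A → MeasurableSet B →
      Tendsto (fun a => corr A B (u a)) l (𝓝 (corr A B T)) := by
  rw [nhds_induced, tendsto_comap_iff, tendsto_pi_nhds]
  exact ⟨fun h A B hA hB => h (⟨A, hA⟩, ⟨B, hB⟩), fun h p => h p.1 p.2 p.1.2 p.2.2⟩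

theorem continuous_corr {A B : Set X} (hA : MeasurableSet A) (hB : MeasurableSet B) :
    Continuous (corr (μ := μ) A B) :=
  continuous_iff_continuousAt.2 fun _ => tendsto_nhds_iff_corr.1 tendsto_id A B hA hB

instance : ContinuousInv (MPAut μ) where
  continuous_inv := continuous_iff_continuousAt.2 fun T => tendsto_nhds_iff_corr.2
    fun A B hA hB => by simpa only [corr_inv hA hB] using (continuous_corr hB hA).tendsto T

theorem tendsto_nhds_iff_imageDist [IsFiniteMeasure μ] {ι : Type*} {l : Filter ι}
    {u : ι → MPAut μ} {T : MPAut μ} :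
    Tendsto u l (𝓝 T) ↔
      ∀ A, MeasurableSet A → Tendsto (fun a => imageDist A (u a) T) l (𝓝 0) := by
  constructor
  · intro h A hA
    induction T using QuotientGroup.induction_on with | H T => ?_
    have hlim := ((tendsto_nhds_iff_corr.1 h _ A (mpPerm.measurableSet_image T hA) hA).const_mul
      2).const_sub (2 * μ.real A)
    rw [← imageDist_mk_eq_sub_corr hA, imageDist_self] at hlim
    exact hlim.congr fun a => (imageDist_mk_eq_sub_corr hA (u a) T).symm
  · refine fun h => tendsto_nhds_iff_corr.2 fun A B hA hB => tendsto_iff_dist_tendsto_zero.2 ?_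
    exact squeeze_zero (fun _ => dist_nonneg)
      (fun a => abs_corr_sub_le_imageDist hA hB (u a) T) (h B hB)

theorem halmosDist_inv (D : DenseFamily μ) (S T : MPAut μ) :
    halmosDist D S⁻¹ T⁻¹ = halmosDist D S T := by
  simp only [halmosDist, inv_inv, add_comm]

variable [IsProbabilityMeasure μ]

instance : IsTopologicalGroup (MPAut μ) where
  continuous_mul := by
    refine continuous_iff_continuousAt.2 fun ⟨S, T⟩ => tendsto_nhds_iff_imageDist.2 fun A hA => ?_
    induction T using QuotientGroup.induction_on with | H T => ?_
    have hS := tendsto_nhds_iff_imageDist.1 (continuous_fst.tendsto (S, (T : MPAut μ))) _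
      (mpPerm.measurableSet_image T hA)
    have hT := tendsto_nhds_iff_imageDist.1 (continuous_snd.tendsto (S, (T : MPAut μ))) A hA
    refine squeeze_zero (fun _ => imageDist_nonneg _ _ _) (fun p => ?_)
      (by simpa only [add_zero] using hT.add hS)
    calc imageDist A (p.1 * p.2) (S * ↑T)
      _ ≤ imageDist A (p.1 * p.2) (p.1 * ↑T) + imageDist A (p.1 * ↑T) (S * ↑T) :=
        imageDist_triangle A _ _ _
      _ = imageDist A p.2 T + imageDist ((T : Equiv.Perm X) '' A) p.1 S := by
        rw [imageDist_mul_left hA, imageDist_mul_right_mk]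

theorem imageDist_le_halmosDist (D : DenseFamily μ) (i : ℕ) (S T : MPAut μ) :
    imageDist (D.set i) S T ≤ 2 ^ i * halmosDist D S T := by
  have hterm : (1 / 2 : ℝ) ^ i * (imageDist (D.set i) S T + imageDist (D.set i) S⁻¹ T⁻¹) ≤
      halmosDist D S T := (summable_halmosDist D S T).le_tsum i fun j _ =>
    mul_nonneg (by positivity) (add_nonneg (imageDist_nonneg _ _ _) (imageDist_nonneg _ _ _))
  calc imageDist (D.set i) S T
    _ ≤ imageDist (D.set i) S T + imageDist (D.set i) S⁻¹ T⁻¹ :=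
      le_add_of_nonneg_right (imageDist_nonneg _ _ _)
    _ = 2 ^ i * ((1 / 2) ^ i *
          (imageDist (D.set i) S T + imageDist (D.set i) S⁻¹ T⁻¹)) := by
      rw [← mul_assoc, ← mul_pow, mul_one_div_cancel two_ne_zero, one_pow, one_mul]
    _ ≤ 2 ^ i * halmosDist D S T := by gcongr

theorem eventually_imageDist_lt_of_halmosDist_lt (D : DenseFamily μ) {A : Set X}
    (hA : MeasurableSet A) {ε : ℝ} (hε : 0 < ε) :
    ∀ᶠ δ in 𝓝[>] (0 : ℝ), ∀ S T : MPAut μ, halmosDist D S T < δ → imageDist A S T < ε := by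
  obtain ⟨i, hi⟩ := D.dense A hA (ε / 4) (by positivity)
  have hδ : 0 < ε / 2 / 2 ^ i := by positivity
  filter_upwards [Ioo_mem_nhdsGT hδ] with δ hδ S T h
  have hAi := imageDist_le_add_symmDiff hA (D.measurableSet i) S T
  have hiD := imageDist_le_halmosDist D i S T
  have hST := (lt_div_iff₀' (by positivity)).1 (h.trans hδ.2)
  rw [symmDiff_comm] at hi
  linarith

theorem tendsto_halmosDist_zero_iff (D : DenseFamily μ) {ι : Type*} {l : Filter ι}
    {u : ι → MPAut μ} {T : MPAut μ} :
    Tendsto (fun a => halmosDist D (u a) T) l (𝓝 0) ↔ Tendsto u l (𝓝 T) := by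
  constructor
  · refine fun h => tendsto_nhds_iff_imageDist.2 fun A hA => Metric.tendsto_nhds.2 fun ε hε => ?_
    obtain ⟨δ, hAδ, hδ⟩ :=
      ((eventually_imageDist_lt_of_halmosDist_lt D hA hε).and self_mem_nhdsWithin).exists
    filter_upwards [h.eventually_lt_const hδ] with a ha
    rw [Real.dist_0_eq_abs, abs_of_nonneg (imageDist_nonneg _ _ _)]
    exact hAδ _ _ ha
  · intro h
    have hterm (i : ℕ) : Tendsto (fun a => (1 / 2 : ℝ) ^ i *
        (imageDist (D.set i) (u a) T + imageDist (D.set i) (u a)⁻¹ T⁻¹)) l (𝓝 0) := by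
      have hi := tendsto_nhds_iff_imageDist.1 h _ (D.measurableSet i)
      have hi' := tendsto_nhds_iff_imageDist.1 h.inv _ (D.measurableSet i)
      simpa only [add_zero, mul_zero] using (hi.add hi').const_mul ((1 / 2 : ℝ) ^ i)
    have hbound (a : ι) (i : ℕ) : ‖(1 / 2 : ℝ) ^ i *
        (imageDist (D.set i) (u a) T + imageDist (D.set i) (u a)⁻¹ T⁻¹)‖ ≤
          (1 / 2 : ℝ) ^ i * 2 := by
      have := imageDist_nonneg (D.set i) (u a) T
      have := imageDist_nonneg (D.set i) (u a)⁻¹ T⁻¹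
      have := imageDist_le_one (D.set i) (u a) T
      have := imageDist_le_one (D.set i) (u a)⁻¹ T⁻¹
      rw [Real.norm_of_nonneg (by positivity)]
      gcongr
      linarith
    simpa only [halmosDist, tsum_zero] using tendsto_tsum_of_dominated_convergence
      (summable_geometric_two.mul_right 2) hterm (.of_forall hbound)

theorem toTopologicalSpace_halmosMetric [StandardBorelSpace X] (D : DenseFamily μ) :
    (halmosMetric D).toPseudoMetricSpace.toUniformSpace.toTopologicalSpace = weakTopology μ := by
  have hiff {l : Filter (MPAut μ)} {T : MPAut μ} :
      l ≤ @nhds _ (halmosMetric D).toPseudoMetricSpace.toUniformSpace.toTopologicalSpace T ↔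
        l ≤ 𝓝 T :=
    Iff.trans (letI := halmosMetric D; tendsto_iff_dist_tendsto_zero (f := id))
      (tendsto_halmosDist_zero_iff D (u := id))
  exact TopologicalSpace.ext_nhds fun T => le_antisymm (hiff.1 le_rfl) (hiff.2 le_rfl)

end WeakTopology

section Realization

variable {X : Type*} {T S : X → X}

open scoped Classical in
/-- The permutation that equals `T` on `G`, with inverse `S` there, and is the identity outside
`G`. -/
def permOfInvOn {G : Set X} (hT : Set.MapsTo T G G) (hS : Set.MapsTo S G G)
    (h : Set.InvOn S T G G) : Equiv.Perm X where
  toFun := G.piecewise T id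
  invFun := G.piecewise S id
  left_inv x := by
    by_cases hx : x ∈ G
    · rw [Set.piecewise_eq_of_mem _ _ _ hx, Set.piecewise_eq_of_mem _ _ _ (hT hx), h.1 hx]
    · rw [Set.piecewise_eq_of_notMem _ _ _ hx, id, Set.piecewise_eq_of_notMem _ _ _ hx, id]
  right_inv x := by
    by_cases hx : x ∈ G
    · rw [Set.piecewise_eq_of_mem _ _ _ hx, Set.piecewise_eq_of_mem _ _ _ (hS hx), h.2 hx]
    · rw [Set.piecewise_eq_of_notMem _ _ _ hx, id, Set.piecewise_eq_of_notMem _ _ _ hx, id]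

/-- The points all of whose iterates under `T` and under `S` are moved by `T` and `S` as by maps
inverse to each other. -/
def invIterates (T S : X → X) : Set X :=
  {x | ∀ n, (S (T (T^[n] x)) = T^[n] x ∧ T (S (T^[n] x)) = T^[n] x) ∧
    S (T (S^[n] x)) = S^[n] x ∧ T (S (S^[n] x)) = S^[n] x}

theorem invIterates_comm (T S : X → X) : invIterates T S = invIterates S T := by
  ext x
  exact forall_congr' fun n => by tauto

theorem mapsTo_invIterates (T S : X → X) :
    Set.MapsTo T (invIterates T S) (invIterates T S) := fun x hx n => by
  refine ⟨(hx (n + 1)).1, ?_⟩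
  cases n with
  | zero => exact (hx 1).1
  | succ n =>
    have hST : S (T x) = x := (hx 0).1.1
    rw [Function.iterate_succ_apply, hST]
    exact (hx n).2

theorem invOn_invIterates (T S : X → X) :
    Set.InvOn S T (invIterates T S) (invIterates T S) :=
  ⟨fun _ hx => (hx 0).1.1, fun _ hx => (hx 0).1.2⟩

variable [MeasurableSpace X] {μ : Measure X}

theorem measurableSet_invIterates [StandardBorelSpace X] (hT : Measurable T) (hS : Measurable S) :
    MeasurableSet (invIterates T S) := by
  have hinv : MeasurableSet {x | S (T x) = x ∧ T (S x) = x} :=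
    (measurableSet_eq_fun (hS.comp hT) measurable_id).inter
      (measurableSet_eq_fun (hT.comp hS) measurable_id)
  rw [invIterates, Set.ofPred_forall]
  exact .iInter fun n => (hT.iterate n hinv).inter (hS.iterate n hinv)

theorem ae_mem_invIterates (hT : MeasurePreserving T μ μ) (hS : MeasurePreserving S μ μ)
    (hST : ∀ᵐ x ∂μ, S (T x) = x) (hTS : ∀ᵐ x ∂μ, T (S x) = x) :
    ∀ᵐ x ∂μ, x ∈ invIterates T S :=
  ae_all_iff.2 fun n =>
    ((hT.iterate n).quasiMeasurePreserving.ae (hST.and hTS)).and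
      ((hS.iterate n).quasiMeasurePreserving.ae (hST.and hTS))

theorem exists_mpPerm_ae_eq [StandardBorelSpace X] (hT : MeasurePreserving T μ μ)
    (hS : MeasurePreserving S μ μ) (hST : ∀ᵐ x ∂μ, S (T x) = x) (hTS : ∀ᵐ x ∂μ, T (S x) = x) :
    ∃ e : mpPerm μ, (e : Equiv.Perm X) =ᵐ[μ] T ∧ (e : Equiv.Perm X).symm =ᵐ[μ] S := by
  classical
  have hG := measurableSet_invIterates hT.measurable hS.measurable
  let e : Equiv.Perm X := permOfInvOn (mapsTo_invIterates T S)
    (invIterates_comm T S ▸ mapsTo_invIterates S T) (invOn_invIterates T S)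
  have he : e =ᵐ[μ] T := by
    filter_upwards [ae_mem_invIterates hT hS hST hTS] with x hx
    exact Set.piecewise_eq_of_mem _ _ _ hx
  have he' : e.symm =ᵐ[μ] S := by
    filter_upwards [ae_mem_invIterates hT hS hST hTS] with x hx
    exact Set.piecewise_eq_of_mem _ _ _ hx
  exact ⟨⟨e, ⟨hT.measurable.piecewise hG measurable_id, by rw [Measure.map_congr he, hT.map_eq]⟩,
    ⟨hS.measurable.piecewise hG measurable_id, by rw [Measure.map_congr he', hS.map_eq]⟩⟩, he, he'⟩

end Realization

section LimitMap

variable {X : Type*} [MeasurableSpace X] {μ : Measure X}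

theorem tendsto_measureReal_symmDiff_of_mem_generateSetAlgebra [IsFiniteMeasure μ] {Y ι : Type*}
    {l : Filter ι} {f : ι → X → Y} {h : X → Y} {s : Set (Set Y)}
    (H : ∀ A ∈ s, Tendsto (fun n => μ.real ((f n ⁻¹' A) ∆ (h ⁻¹' A))) l (𝓝 0)) {A : Set Y}
    (hA : A ∈ generateSetAlgebra s) :
    Tendsto (fun n => μ.real ((f n ⁻¹' A) ∆ (h ⁻¹' A))) l (𝓝 0) := by
  induction hA with
  | base A hA => exact H A hA
  | empty => simpa only [Set.preimage_empty, symmDiff_self, Set.bot_eq_empty, measureReal_empty]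
      using tendsto_const_nhds
  | compl A _ ih => simpa only [Set.preimage_compl, compl_symmDiff_compl] using ih
  | union A B _ _ ihA ihB =>
    refine squeeze_zero (fun _ => measureReal_nonneg) (fun n => ?_)
      (by simpa only [add_zero] using ihA.add ihB)
    exact (measureReal_mono Set.union_symmDiff_union_subset).trans (measureReal_union_le _ _)

theorem tendsto_measureReal_symmDiff_of_generateFrom [IsFiniteMeasure μ] {Y ι : Type*}
    [mY : MeasurableSpace Y] {ν : Measure Y} [IsFiniteMeasure ν] {l : Filter ι} {f : ι → X → Y}
    (hf : ∀ n, MeasurePreserving (f n) μ ν) {h : X → Y} (hh : Measurable h) {s : Set (Set Y)}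
    (hs : mY = MeasurableSpace.generateFrom s)
    (H : ∀ A ∈ s, Tendsto (fun n => μ.real ((f n ⁻¹' A) ∆ (h ⁻¹' A))) l (𝓝 0)) {A : Set Y}
    (hA : MeasurableSet A) :
    Tendsto (fun n => μ.real ((f n ⁻¹' A) ∆ (h ⁻¹' A))) l (𝓝 0) := by
  refine Metric.tendsto_nhds.2 fun ε hε => ?_
  have halg := isSetAlgebra_generateSetAlgebra (𝒜 := s)
  have hsalg : mY = MeasurableSpace.generateFrom (generateSetAlgebra s) := by
    rw [generateFrom_generateSetAlgebra_eq, hs]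
  obtain ⟨C, hC, hCA⟩ := exists_measure_symmDiff_lt_of_generateFrom_isSetRing
    (μ := ν + μ.map h) halg.isSetRing ⟨{Set.univ}, Set.countable_singleton _,
      Set.singleton_subset_iff.2 halg.univ_mem, by simp⟩ hsalg hA
    (ε := ENNReal.ofReal (ε / 2)) (by simpa using hε)
  have hCm : MeasurableSet C := hsalg ▸ MeasurableSpace.measurableSet_generateFrom hC
  have hCA' : ν.real (C ∆ A) + μ.real ((h ⁻¹' C) ∆ (h ⁻¹' A)) < ε / 2 := by
    rw [← Set.preimage_symmDiff, ← map_measureReal_apply hh (hCm.symmDiff hA),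
      ← measureReal_add_apply]
    exact (ENNReal.lt_ofReal_iff_toReal_lt (measure_ne_top _ _)).1 hCA
  filter_upwards [(tendsto_measureReal_symmDiff_of_mem_generateSetAlgebra H hC).eventually_lt_const
    (half_pos hε)] with n hn
  have hfn : μ.real ((f n ⁻¹' A) ∆ (f n ⁻¹' C)) = ν.real (C ∆ A) := by
    rw [← Set.preimage_symmDiff, symmDiff_comm,
      (hf n).measureReal_preimage (hCm.symmDiff hA).nullMeasurableSet]
  have htri := measureReal_symmDiff_le (μ := μ) (s := f n ⁻¹' A) (t := f n ⁻¹' C) (h ⁻¹' A)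
  have htri' := measureReal_symmDiff_le (μ := μ) (s := f n ⁻¹' C) (t := h ⁻¹' C) (h ⁻¹' A)
  rw [Real.dist_0_eq_abs, abs_of_nonneg measureReal_nonneg]
  linarith

theorem measurePreserving_of_tendsto_symmDiff [IsFiniteMeasure μ] {Y ι : Type*}
    [MeasurableSpace Y] {ν : Measure Y} [IsFiniteMeasure ν] {l : Filter ι} [l.NeBot]
    {f : ι → X → Y} (hf : ∀ n, MeasurePreserving (f n) μ ν) {h : X → Y} (hh : Measurable h)
    (H : ∀ A, MeasurableSet A → Tendsto (fun n => μ.real ((f n ⁻¹' A) ∆ (h ⁻¹' A))) l (𝓝 0)) :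
    MeasurePreserving h μ ν := by
  refine ⟨hh, Measure.ext fun A hA =>
    (ENNReal.toReal_eq_toReal_iff' (measure_ne_top _ _) (measure_ne_top _ _)).1 ?_⟩
  have hlim : Tendsto (fun n => μ.real (f n ⁻¹' A)) l (𝓝 (μ.real (h ⁻¹' A))) :=
    tendsto_iff_dist_tendsto_zero.2 (squeeze_zero (fun _ => dist_nonneg)
      (fun n => abs_measureReal_sub_le_measureReal_symmDiff
        ((hf n).measurable hA).nullMeasurableSet (hh hA).nullMeasurableSet) (H A hA))
  simp only [(hf _).measureReal_preimage hA.nullMeasurableSet] at hlim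
  rw [Measure.map_apply hh hA]
  exact tendsto_nhds_unique hlim tendsto_const_nhds

theorem eventually_iff_of_forall_ge_succ {p : ℕ → Prop} {n : ℕ}
    (h : ∀ m ≥ n, p m ↔ p (m + 1)) : (∀ᶠ m in atTop, p m) ↔ p n := by
  have hconst : ∀ m ≥ n, p m ↔ p n :=
    fun m hm => Nat.le_induction .rfl (fun k hk ih => (h k hk).symm.trans ih) m hm
  refine ⟨fun hev => ?_, fun hn => eventually_atTop.2 ⟨n, fun m hm => (hconst m hm).2 hn⟩⟩
  obtain ⟨m, hm, hnm⟩ := (hev.and (eventually_ge_atTop n)).exists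
  exact (hconst m hnm).1 hm

theorem tendsto_measureReal_symmDiff_eventually_mem {Y : Type*} {f : ℕ → X → Y} {B : Set Y}
    (H : ∑' n, μ ((f n ⁻¹' B) ∆ (f (n + 1) ⁻¹' B)) ≠ ∞) :
    Tendsto (fun n => μ.real ((f n ⁻¹' B) ∆ {x | ∀ᶠ n in atTop, f n x ∈ B})) atTop (𝓝 0) := by
  refine (ENNReal.tendsto_toReal ENNReal.zero_ne_top).comp
    (tendsto_of_tendsto_of_tendsto_of_le_of_le tendsto_const_nhds
      (ENNReal.tendsto_sum_nat_add _ H) (fun _ => zero_le) fun n => ?_)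
  refine (measure_mono fun x hx => ?_).trans (measure_iUnion_le _)
  contrapose! hx
  simp only [Set.mem_iUnion, not_exists, Set.mem_symmDiff, Set.mem_preimage] at hx
  have hiff : (∀ᶠ m in atTop, f m x ∈ B) ↔ f n x ∈ B :=
    eventually_iff_of_forall_ge_succ fun m hm => by
      have := hx (m - n)
      rw [Nat.sub_add_cancel hm] at this
      tauto
  rw [Set.mem_symmDiff, Set.mem_preimage, Set.mem_ofPred_eq, hiff]
  tauto

theorem pi_prop_eq_generateFrom (ι : Type*) :
    (MeasurableSpace.pi : MeasurableSpace (ι → Prop)) =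
      .generateFrom (Set.range fun i => {y : ι → Prop | y i}) := by
  refine le_antisymm (iSup_le fun i => ?_) (MeasurableSpace.generateFrom_le ?_)
  · exact Measurable.comap_le ((@measurableSet_setOfPred _ (_) _).1
      (MeasurableSpace.measurableSet_generateFrom ⟨i, rfl⟩))
  · rintro _ ⟨i, rfl⟩
    exact measurableSet_setOfPred.2 (measurable_pi_apply i)

theorem exists_measurePreserving_tendsto_symmDiff [StandardBorelSpace X] [Nonempty X]
    [IsFiniteMeasure μ] {f : ℕ → X → X} (hf : ∀ n, MeasurePreserving (f n) μ μ) {B : ℕ → Set X}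
    (hB : ∀ i, MeasurableSet (B i)) (hsep : Function.Injective fun x i => x ∈ B i)
    (H : ∀ i, ∑' n, μ ((f n ⁻¹' B i) ∆ (f (n + 1) ⁻¹' B i)) ≠ ∞) :
    ∃ g : X → X, MeasurePreserving g μ μ ∧ ∀ A, MeasurableSet A →
      Tendsto (fun n => μ.real ((f n ⁻¹' A) ∆ (g ⁻¹' A))) atTop (𝓝 0) := by
  let code : X → ℕ → Prop := fun x i => x ∈ B i
  let lim : X → ℕ → Prop := fun x i => ∀ᶠ n in atTop, f n x ∈ B i
  have hcode : MeasurableEmbedding code :=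
    (measurable_pi_iff.2 fun i => measurable_mem.2 (hB i)).measurableEmbedding hsep
  have hcode_mp : MeasurePreserving code μ (μ.map code) := hcode.measurable.measurePreserving μ
  have hcode_f (n : ℕ) : MeasurePreserving (code ∘ f n) μ (μ.map code) := hcode_mp.comp (hf n)
  have hlim : Measurable lim := measurable_pi_iff.2 fun i => measurableSet_setOfPred.1 <| by
    simpa only [← Set.mem_preimage, ← Filter.mem_liminf_iff_eventually_mem, Set.ofPred_mem_eq, lim]
      using MeasurableSet.measurableSet_liminf fun n => (hf n).measurable (hB i)
  have htendsto (E : Set (ℕ → Prop)) (hE : MeasurableSet E) :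
      Tendsto (fun n => μ.real (((code ∘ f n) ⁻¹' E) ∆ (lim ⁻¹' E))) atTop (𝓝 0) :=
    tendsto_measureReal_symmDiff_of_generateFrom hcode_f hlim (pi_prop_eq_generateFrom ℕ)
      (Set.forall_mem_range.2 fun i => tendsto_measureReal_symmDiff_eventually_mem (H i)) hE
  obtain ⟨decode, hdecode, hinv⟩ :=
    hcode.exists_measurable_extend measurable_id fun _ => inferInstance
  have htendsto' (A : Set X) (hA : MeasurableSet A) :
      Tendsto (fun n => μ.real ((f n ⁻¹' A) ∆ ((decode ∘ lim) ⁻¹' A))) atTop (𝓝 0) := by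
    refine (htendsto _ (hdecode hA)).congr fun n => ?_
    rw [← Set.preimage_comp, ← Set.preimage_comp, ← Function.comp_assoc, hinv, Function.id_comp]
  exact ⟨decode ∘ lim, measurePreserving_of_tendsto_symmDiff hf (hdecode.comp hlim) htendsto',
    htendsto'⟩

theorem exists_measurableSet_seq_separating (X : Type*) [MeasurableSpace X]
    [StandardBorelSpace X] :
    ∃ B : ℕ → Set X, (∀ i, MeasurableSet (B i)) ∧ Function.Injective fun x i => x ∈ B i := by
  refine ⟨MeasurableSpace.natGeneratingSequence X,
    MeasurableSpace.measurableSet_natGeneratingSequence, fun x y hxy =>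
      MeasurableSpace.injective_mapNatBool X (funext fun n => ?_)⟩
  simpa only [MeasurableSpace.mapNatBool, decide_eq_decide, eq_iff_iff] using congrFun hxy n

end LimitMap

section Complete

variable {X : Type*} [MeasurableSpace X] {μ : Measure X} [IsProbabilityMeasure μ]

theorem ae_comp_eq_id_of_tendsto [StandardBorelSpace X] {e : ℕ → mpPerm μ} {g g' : X → X}
    (hg : MeasurePreserving g μ μ)
    (h : ∀ A, MeasurableSet A →
      Tendsto (fun n => μ.real (((e n : Equiv.Perm X) ⁻¹' A) ∆ (g ⁻¹' A))) atTop (𝓝 0))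
    (h' : ∀ A, MeasurableSet A →
      Tendsto (fun n => μ.real (((e n : Equiv.Perm X) '' A) ∆ (g' ⁻¹' A))) atTop (𝓝 0)) :
    ∀ᵐ x ∂μ, g (g' x) = x := by
  refine EventuallyEq.of_forall_separating_preimage (f := g ∘ g') (g := id) MeasurableSet
    fun A hA => ?_
  rw [← measure_symmDiff_eq_zero_iff, ← measureReal_eq_zero_iff]
  refine tendsto_nhds_unique (tendsto_const_nhds (f := atTop (α := ℕ)))
    (squeeze_zero (fun _ => measureReal_nonneg) (fun n => ?_)
      (by simpa only [add_zero] using (h' _ (hg.measurable hA)).add (h A hA)))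
  have htri := measureReal_symmDiff_le (μ := μ) (s := g' ⁻¹' (g ⁻¹' A))
    (t := (e n : Equiv.Perm X) '' (g ⁻¹' A)) A
  have himage : μ.real (((e n : Equiv.Perm X) '' (g ⁻¹' A)) ∆ A) =
      μ.real (((e n : Equiv.Perm X) ⁻¹' A) ∆ (g ⁻¹' A)) := by
    rw [← mpPerm.measureReal_image (e n)
      ((mpPerm.measurable (e n) hA).symmDiff (hg.measurable hA)),
      Set.image_symmDiff (e n : Equiv.Perm X).injective, Equiv.image_preimage, symmDiff_comm]
  rw [himage, symmDiff_comm (g' ⁻¹' _) (_ '' _)] at htri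
  exact htri

theorem exists_measurePreserving_of_imageDist_lt [StandardBorelSpace X] {B : ℕ → Set X}
    (hB : ∀ i, MeasurableSet (B i)) (hsep : Function.Injective fun x i => x ∈ B i)
    {e : ℕ → mpPerm μ}
    (he : ∀ n, ∀ i ≤ n, imageDist (B i) (e n : MPAut μ)⁻¹ (e (n + 1) : MPAut μ)⁻¹ < (1 / 2) ^ n) :
    ∃ g : X → X, MeasurePreserving g μ μ ∧ ∀ A, MeasurableSet A →
      Tendsto (fun n => μ.real (((e n : Equiv.Perm X) ⁻¹' A) ∆ (g ⁻¹' A))) atTop (𝓝 0) := by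
  have : Nonempty X := μ.nonempty_of_neZero
  refine exists_measurePreserving_tendsto_symmDiff (fun n => mpPerm.measurePreserving (e n)) hB
    hsep fun i => ?_
  have hsummable : Summable fun n =>
      μ.real (((e n : Equiv.Perm X) ⁻¹' B i) ∆ ((e (n + 1) : Equiv.Perm X) ⁻¹' B i)) := by
    refine .of_norm_bounded_eventually_nat summable_geometric_two ?_
    filter_upwards [eventually_ge_atTop i] with n hn
    rw [Real.norm_of_nonneg measureReal_nonneg, ← imageDist_inv_mk]
    exact (he n i hn).le
  simpa only [ofReal_measureReal (measure_ne_top _ _)] using hsummable.tsum_ofReal_ne_top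

theorem exists_tendsto_of_imageDist_lt [StandardBorelSpace X] {B : ℕ → Set X}
    (hB : ∀ i, MeasurableSet (B i)) (hsep : Function.Injective fun x i => x ∈ B i)
    {u : ℕ → MPAut μ} (hu : ∀ n, ∀ i ≤ n, imageDist (B i) (u n) (u (n + 1)) < (1 / 2) ^ n)
    (hu' : ∀ n, ∀ i ≤ n, imageDist (B i) (u n)⁻¹ (u (n + 1))⁻¹ < (1 / 2) ^ n) :
    ∃ T, Tendsto u atTop (𝓝 T) := by
  choose e he using fun n => QuotientGroup.mk_surjective (s := trivialPerm μ) (u n)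
  obtain rfl : (fun n => (e n : MPAut μ)) = u := funext he
  obtain ⟨g, hg, hlim⟩ := exists_measurePreserving_of_imageDist_lt hB hsep hu'
  obtain ⟨g', hg', hlim'⟩ := exists_measurePreserving_of_imageDist_lt (e := fun n => (e n)⁻¹) hB
    hsep (by simpa only [QuotientGroup.mk_inv, inv_inv] using hu)
  have himage (n : ℕ) (A : Set X) :
      ((e n)⁻¹ : mpPerm μ) ⁻¹' A = (e n : Equiv.Perm X) '' A :=
    (Equiv.image_eq_preimage_symm _ _).symm
  have hpreimage (n : ℕ) (A : Set X) : ((e n)⁻¹ : mpPerm μ) '' A = (e n : Equiv.Perm X) ⁻¹' A :=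
    Equiv.image_symm_eq_preimage _ _
  obtain ⟨T, hTg, -⟩ := exists_mpPerm_ae_eq hg hg'
    (ae_comp_eq_id_of_tendsto hg' hlim' (by simpa only [hpreimage] using hlim))
    (ae_comp_eq_id_of_tendsto hg hlim (by simpa only [himage] using hlim'))
  refine ⟨T, tendsto_inv_iff.1 (tendsto_nhds_iff_imageDist.2 fun A hA => ?_)⟩
  refine (hlim A hA).congr fun n => ?_
  rw [imageDist_inv_mk]
  exact measureReal_congr (EventuallyEq.rfl.symmDiff (hTg.symm.preimage A))

theorem completeSpace_halmosMetric [StandardBorelSpace X] (D : DenseFamily μ) :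
    @CompleteSpace (MPAut μ) (halmosMetric D).toPseudoMetricSpace.toUniformSpace := by
  let := halmosMetric D
  obtain ⟨B, hB, hsep⟩ := exists_measurableSet_seq_separating X
  have hδ (N : ℕ) : ∃ δ : ℝ, (∀ i ∈ Set.Iic N, ∀ S T : MPAut μ, halmosDist D S T < δ →
      imageDist (B i) S T < (1 / 2) ^ N) ∧ 0 < δ :=
    (((eventually_all_finite (Set.finite_Iic N)).2 fun i _ =>
      eventually_imageDist_lt_of_halmosDist_lt D (hB i) (by positivity)).and
        self_mem_nhdsWithin).exists
  choose δ hδ hδ_pos using hδ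
  refine Metric.complete_of_convergent_controlled_sequences δ hδ_pos fun u hu => ?_
  have hdist (n : ℕ) : halmosDist D (u n) (u (n + 1)) < δ n := hu n n (n + 1) le_rfl n.le_succ
  obtain ⟨T, hT⟩ := exists_tendsto_of_imageDist_lt hB hsep
    (fun n i hi => hδ n i hi _ _ (hdist n))
    (fun n i hi => hδ n i hi _ _ ((halmosDist_inv D _ _).trans_lt (hdist n)))
  exact ⟨T, tendsto_iff_dist_tendsto_zero.2 ((tendsto_halmosDist_zero_iff D).2 hT)⟩

theorem baireSpace_mpAut [StandardBorelSpace X] (D : DenseFamily μ) : BaireSpace (MPAut μ) := by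
  have := completeSpace_halmosMetric D
  rw [← toTopologicalSpace_halmosMetric D]
  let := halmosMetric D
  infer_instance

theorem isFirstCategory_iff_isMeagre [StandardBorelSpace X] (D : DenseFamily μ)
    {s : Set (MPAut μ)} : IsFirstCategory D s ↔ IsMeagre s := by
  rw [IsFirstCategory, toTopologicalSpace_halmosMetric]

theorem IsFirstCategory.mono [StandardBorelSpace X] {D : DenseFamily μ} {s t : Set (MPAut μ)}
    (ht : IsFirstCategory D t) (hst : s ⊆ t) : IsFirstCategory D s := by
  rw [isFirstCategory_iff_isMeagre] at ht ⊢
  exact ht.mono hst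

theorem isGeneric_iff_mem_residual [StandardBorelSpace X] (D : DenseFamily μ)
    {s : Set (MPAut μ)} : IsGeneric D s ↔ s ∈ residual (MPAut μ) := by
  have := baireSpace_mpAut D
  rw [IsGeneric, mem_residual, toTopologicalSpace_halmosMetric]

end Complete

section Quantile

open ProbabilityTheory Set

/-- The uniform distribution on the unit interval. -/
abbrev uniformUnit : Measure ℝ := volume.restrict (Ioo 0 1)

/-- The quantile function of `ν`, the generalised inverse of its distribution function; it is set
to zero outside `(0, 1)`, where the infimum may be over an empty or unbounded set. -/
def quantile (ν : Measure ℝ) : ℝ → ℝ :=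
  (Ioo 0 1).indicator fun u => sInf {t | u ≤ cdf ν t}

variable (ν : Measure ℝ)

theorem quantile_le_iff {u : ℝ} (hu : u ∈ Ioo 0 1) {t : ℝ} :
    quantile ν u ≤ t ↔ u ≤ cdf ν t := by
  have hne : {t | u ≤ cdf ν t}.Nonempty :=
    ((tendsto_cdf_atTop ν).eventually (eventually_ge_nhds hu.2)).exists
  have hbdd : BddBelow {t | u ≤ cdf ν t} := by
    obtain ⟨b, hb⟩ := ((tendsto_cdf_atBot ν).eventually (eventually_lt_nhds hu.1)).exists
    exact ⟨b, fun t ht => le_of_not_gt fun htb =>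
      ht.not_gt ((monotone_cdf ν htb.le).trans_lt hb)⟩
  rw [quantile, indicator_of_mem hu]
  refine ⟨fun h => ?_, fun h => csInf_le hbdd h⟩
  have hright : Tendsto (cdf ν) (𝓝[>] sInf {t | u ≤ cdf ν t}) (𝓝 (cdf ν (sInf _))) :=
    ((cdf ν).right_continuous _).mono_left (nhdsWithin_mono _ Ioi_subset_Ici_self)
  refine (ge_of_tendsto hright ?_).trans (monotone_cdf ν h)
  filter_upwards [self_mem_nhdsWithin] with s hs
  obtain ⟨r, hr, hrs⟩ := exists_lt_of_csInf_lt hne hs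
  exact hr.trans (monotone_cdf ν hrs.le)

theorem measurable_quantile : Measurable (quantile ν) := by
  refine measurable_of_Iic fun t => ?_
  have hpre : quantile ν ⁻¹' Iic t ∩ Ioo 0 1 = Iic (cdf ν t) ∩ Ioo 0 1 := by
    ext u
    exact and_congr_left fun hu => quantile_le_iff ν hu
  have hpre' : quantile ν ⁻¹' Iic t \ Ioo 0 1 = {_u | 0 ≤ t} \ Ioo 0 1 := by
    ext u
    refine and_congr_left fun hu => ?_
    rw [mem_preimage, quantile, indicator_of_notMem hu]
    rfl
  rw [← inter_union_sdiff (quantile ν ⁻¹' Iic t) (Ioo 0 1), hpre, hpre']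
  exact (measurableSet_Iic.inter measurableSet_Ioo).union
    ((MeasurableSet.const _).diff measurableSet_Ioo)

variable [IsProbabilityMeasure ν]

theorem measurePreserving_quantile : MeasurePreserving (quantile ν) uniformUnit ν := by
  refine ⟨measurable_quantile ν, Measure.ext_of_Iic _ _ fun t => ?_⟩
  have hpre : quantile ν ⁻¹' Iic t =ᵐ[uniformUnit] Iic (cdf ν t) := by
    filter_upwards [ae_restrict_mem measurableSet_Ioo] with u hu
    exact propext (quantile_le_iff ν hu)
  rw [Measure.map_apply (measurable_quantile ν) measurableSet_Iic, measure_congr hpre, uniformUnit,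
    restrict_Ioo_eq_restrict_Ioc, Measure.restrict_apply measurableSet_Iic, inter_comm,
    Ioc_inter_Iic, Real.volume_Ioc, sub_zero, min_eq_right (cdf_le_one ν t), ofReal_cdf]

variable [NullSingletonClass ν]

theorem continuous_cdf : Continuous (cdf ν) := by
  refine continuous_iff_continuousAt.2 fun x => ?_
  rw [(monotone_cdf ν).continuousAt_iff_leftLim_eq_rightLim, StieltjesFunction.rightLim_eq]
  have hjump : ν {x} = 0 := measure_singleton x
  rw [← measure_cdf ν, StieltjesFunction.measure_singleton, ENNReal.ofReal_eq_zero] at hjump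
  exact le_antisymm ((monotone_cdf ν).leftLim_le le_rfl) (sub_nonpos.1 hjump)

theorem cdf_quantile {u : ℝ} (hu : u ∈ Ioo 0 1) : cdf ν (quantile ν u) = u := by
  refine le_antisymm ?_ ((quantile_le_iff ν hu).1 le_rfl)
  refine le_of_tendsto ((continuous_cdf ν).continuousWithinAt (s := Iio (quantile ν u))) ?_
  filter_upwards [self_mem_nhdsWithin] with t ht
  exact (not_le.1 fun h => not_le.2 ht ((quantile_le_iff ν hu).2 h)).le

theorem ae_cdf_quantile : ∀ᵐ u ∂uniformUnit, cdf ν (quantile ν u) = u := by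
  filter_upwards [ae_restrict_mem measurableSet_Ioo] with u hu using cdf_quantile ν hu

theorem ae_quantile_cdf : ∀ᵐ t ∂ν, quantile ν (cdf ν t) = t := by
  have hm : Measurable fun t => quantile ν (cdf ν t) :=
    (measurable_quantile ν).comp (monotone_cdf ν).measurable
  have hae : ∀ᵐ t ∂uniformUnit.map (quantile ν), quantile ν (cdf ν t) = t := by
    refine (ae_map_iff (measurable_quantile ν).aemeasurable
      (measurableSet_eq_fun hm measurable_id)).2 ?_
    filter_upwards [ae_cdf_quantile ν] with u hu
    rw [hu, id]
  rwa [(measurePreserving_quantile ν).map_eq] at hae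

theorem measurePreserving_cdf : MeasurePreserving (cdf ν) ν uniformUnit := by
  have hm : Measurable (cdf ν) := (monotone_cdf ν).measurable
  have hmap : (uniformUnit.map (quantile ν)).map (cdf ν) = uniformUnit := by
    rw [Measure.map_map hm (measurable_quantile ν)]
    exact (Measure.map_congr (ae_cdf_quantile ν)).trans Measure.map_id
  rw [(measurePreserving_quantile ν).map_eq] at hmap
  exact ⟨hm, hmap⟩

end Quantile

section Isomorphism

open ProbabilityTheory

variable {X : Type*} [MeasurableSpace X]

theorem exists_measurableEmbedding_real_le_iff_lt [StandardBorelSpace X] {c : X → ℕ}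
    (hc : Measurable c) :
    ∃ code : X → ℝ, MeasurableEmbedding code ∧ ∀ x (n : ℕ), code x ≤ n ↔ c x < n := by
  let frac : X → ℝ := fun x => Real.sigmoid (embeddingReal X x)
  have hfrac : Measurable frac := continuous_sigmoid.measurable.comp (measurable_embeddingReal X)
  have hiff (x : X) (n : ℕ) : (c x : ℝ) + frac x ≤ n ↔ c x < n := by
    have hpos : 0 < frac x := Real.sigmoid_pos _
    have hlt : frac x < 1 := Real.sigmoid_lt_one _
    refine ⟨fun h => Nat.cast_lt.1 (by linarith : (c x : ℝ) < n), fun h => ?_⟩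
    have hsucc : (c x : ℝ) + 1 ≤ n := mod_cast h
    linarith
  refine ⟨fun x => c x + frac x, Measurable.measurableEmbedding (by fun_prop) fun x y hxy => ?_,
    hiff⟩
  beta_reduce at hxy
  have hcxy : c x = c y := eq_of_forall_gt_iff fun n => by rw [← hiff, ← hiff, hxy]
  rw [hcxy, add_right_inj] at hxy
  exact (measurableEmbedding_embeddingReal X).injective (Real.sigmoid_injective hxy)

theorem nullSingletonClass_map {μ : Measure X} [NullSingletonClass μ] {Y : Type*}
    [MeasurableSpace Y] {f : X → Y} (hf : MeasurableEmbedding f) :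
    NullSingletonClass (μ.map f) where
  measure_singleton y := by
    rw [hf.map_apply]
    exact (Set.subsingleton_singleton.preimage hf.injective).measure_zero μ

/-- Two measure-preserving maps between `(X, μ)` and `(Z, ν)` that are inverse to each other almost
everywhere, i.e. an isomorphism modulo null sets. -/
structure AEIso {X Z : Type*} [MeasurableSpace X] [MeasurableSpace Z] (μ : Measure X)
    (ν : Measure Z) where
  toFun : X → Z
  invFun : Z → X
  measurePreserving_toFun : MeasurePreserving toFun μ ν
  measurePreserving_invFun : MeasurePreserving invFun ν μ
  left_inv : ∀ᵐ x ∂μ, invFun (toFun x) = x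
  right_inv : ∀ᵐ z ∂ν, toFun (invFun z) = z

namespace AEIso

variable {Y Z : Type*} [MeasurableSpace Y] [MeasurableSpace Z] {μ : Measure X} {ν : Measure Y}
  {ξ : Measure Z}

/-- The inverse isomorphism. -/
@[simps]
def symm (Φ : AEIso μ ν) : AEIso ν μ where
  toFun := Φ.invFun
  invFun := Φ.toFun
  measurePreserving_toFun := Φ.measurePreserving_invFun
  measurePreserving_invFun := Φ.measurePreserving_toFun
  left_inv := Φ.right_inv
  right_inv := Φ.left_inv

/-- The composition of two isomorphisms, in diagrammatic order. -/
@[simps]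
def trans (Φ : AEIso μ ν) (Ψ : AEIso ν ξ) : AEIso μ ξ where
  toFun := Ψ.toFun ∘ Φ.toFun
  invFun := Φ.invFun ∘ Ψ.invFun
  measurePreserving_toFun := Ψ.measurePreserving_toFun.comp Φ.measurePreserving_toFun
  measurePreserving_invFun := Φ.measurePreserving_invFun.comp Ψ.measurePreserving_invFun
  left_inv := by
    filter_upwards [Φ.left_inv,
      Φ.measurePreserving_toFun.quasiMeasurePreserving.ae Ψ.left_inv] with x hΦ hΨ
    simp only [Function.comp_apply, hΨ, hΦ]
  right_inv := by
    filter_upwards [Ψ.right_inv,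
      Ψ.measurePreserving_invFun.quasiMeasurePreserving.ae Φ.right_inv] with x hΨ hΦ
    simp only [Function.comp_apply, hΨ, hΦ]

theorem exists_of_measurableEmbedding [Nonempty X] {f : X → Y}
    (hf : MeasurableEmbedding f) : ∃ Φ : AEIso μ (μ.map f), Φ.toFun = f := by
  obtain ⟨g, hg, hgf⟩ := hf.exists_measurable_extend measurable_id fun _ => inferInstance
  refine ⟨⟨f, g, hf.measurable.measurePreserving μ, ⟨hg, ?_⟩, .of_forall (congrFun hgf), ?_⟩, rfl⟩
  · rw [Measure.map_map hg hf.measurable, hgf, Measure.map_id]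
  · exact hf.ae_map_iff.2 (.of_forall fun x => congrArg f (congrFun hgf x))

/-- The isomorphism of a non-atomic law on the line with the uniform distribution. -/
def ofCdf (ν : Measure ℝ) [IsProbabilityMeasure ν] [NullSingletonClass ν] :
    AEIso ν uniformUnit where
  toFun := cdf ν
  invFun := quantile ν
  measurePreserving_toFun := measurePreserving_cdf ν
  measurePreserving_invFun := measurePreserving_quantile ν
  left_inv := ae_quantile_cdf ν
  right_inv := ae_cdf_quantile ν

end AEIso

variable {μ : Measure X} [StandardBorelSpace X] [IsProbabilityMeasure μ] [NullSingletonClass μ]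

/-- The levels of `c` are laid out from left to right along the interval, so that only their
measures matter: two maps with the same law become equal under the resulting isomorphisms. -/
theorem exists_aeIso_uniformUnit {c : X → ℕ} (hc : Measurable c) :
    ∃ Φ : AEIso μ uniformUnit,
      ∀ᵐ u ∂uniformUnit, ∀ n, c (Φ.invFun u) < n ↔ u ≤ (μ.map c).real (Set.Iio n) := by
  have : Nonempty X := μ.nonempty_of_neZero
  obtain ⟨code, hcode, hiff⟩ := exists_measurableEmbedding_real_le_iff_lt hc
  have := nullSingletonClass_map (μ := μ) hcode
  have := Measure.isProbabilityMeasure_map (μ := μ) hcode.measurable.aemeasurable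
  obtain ⟨Ψ, hΨcode⟩ := AEIso.exists_of_measurableEmbedding (μ := μ) hcode
  refine ⟨Ψ.trans (.ofCdf _), ?_⟩
  filter_upwards [ae_restrict_mem measurableSet_Ioo,
    (measurePreserving_quantile _).quasiMeasurePreserving.ae Ψ.right_inv] with u hu hΨ n
  have hcdf : cdf (μ.map code) n = (μ.map c).real (Set.Iio n) := by
    rw [cdf_eq_real, map_measureReal_apply hcode.measurable measurableSet_Iic,
      map_measureReal_apply hc measurableSet_Iio]
    exact congrArg μ.real (Set.ext fun x => hiff x n)
  rw [hΨcode] at hΨ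
  rw [← hcdf, ← quantile_le_iff _ hu, ← hiff]
  exact iff_of_eq (congrArg (· ≤ (n : ℝ)) hΨ)

theorem exists_aeIso_comp_eq {Z : Type*} [MeasurableSpace Z] [StandardBorelSpace Z]
    {ν : Measure Z} [IsProbabilityMeasure ν] [NullSingletonClass ν] {c : X → ℕ}
    (hc : Measurable c) {d : Z → ℕ} (hd : Measurable d) (hcd : μ.map c = ν.map d) :
    ∃ Φ : AEIso ν μ, ∀ᵐ z ∂ν, c (Φ.toFun z) = d z := by
  obtain ⟨Φ, hΦ⟩ := exists_aeIso_uniformUnit (μ := μ) hc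
  obtain ⟨Ψ, hΨ⟩ := exists_aeIso_uniformUnit (μ := ν) hd
  refine ⟨Ψ.trans Φ.symm, ?_⟩
  filter_upwards [Ψ.left_inv, Ψ.measurePreserving_toFun.quasiMeasurePreserving.ae (hΦ.and hΨ)]
    with z hz ⟨hΦz, hΨz⟩
  rw [hz, ← hcd] at hΨz
  exact eq_of_forall_gt_iff fun n => (hΦz n).trans (hΨz n).symm

end Isomorphism

section Conjugation

variable {X Z : Type*} [MeasurableSpace X] [MeasurableSpace Z] {μ : Measure X} {ν : Measure Z}

theorem exists_measurable_nat_preimage_eq {κ : Type*} [Finite κ] {A : κ → Set X}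
    (hA : ∀ k, MeasurableSet (A k)) :
    ∃ c : X → ℕ, Measurable c ∧ ∀ k, ∃ S : Set ℕ, c ⁻¹' S = A k := by
  obtain ⟨code, hcode⟩ := exists_injective_nat (κ → Prop)
  refine ⟨fun x => code fun k => x ∈ A k,
    (measurable_of_countable code).comp (measurable_pi_iff.2 fun k => measurable_mem.2 (hA k)),
    fun k => ⟨code '' {p | p k}, ?_⟩⟩
  ext x
  exact hcode.mem_set_image

theorem AEIso.exists_mpPerm_conj [StandardBorelSpace X] (Φ : AEIso ν μ) (σ : mpPerm ν) :
    ∃ T : mpPerm μ, ∀ n : ℕ, ∀ᵐ z ∂ν, ((T ^ n : mpPerm μ) : Equiv.Perm X) (Φ.toFun z) =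
      Φ.toFun ((σ : Equiv.Perm Z)^[n] z) := by
  have hconj (σ σ' : mpPerm ν) (hσ : Function.LeftInverse (σ' : Equiv.Perm Z) σ) :
      ∀ᵐ x ∂μ, Φ.toFun ((σ' : Equiv.Perm Z) (Φ.invFun
        (Φ.toFun ((σ : Equiv.Perm Z) (Φ.invFun x))))) = x := by
    filter_upwards [(σ.2.1.comp Φ.measurePreserving_invFun).quasiMeasurePreserving.ae Φ.left_inv,
      Φ.right_inv] with x hx hx'
    rw [Function.comp_apply] at hx
    rw [hx, hσ, hx']
  have hmp (σ : mpPerm ν) := Φ.measurePreserving_toFun.comp (σ.2.1.comp Φ.measurePreserving_invFun)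
  obtain ⟨T, hT, -⟩ := exists_mpPerm_ae_eq (hmp σ) (hmp σ⁻¹)
    (hconj σ σ⁻¹ (σ : Equiv.Perm Z).symm_apply_apply)
    (hconj σ⁻¹ σ (σ : Equiv.Perm Z).apply_symm_apply)
  have hTΦ : ∀ᵐ z ∂ν, (T : Equiv.Perm X) (Φ.toFun z) = Φ.toFun ((σ : Equiv.Perm Z) z) := by
    filter_upwards [Φ.measurePreserving_toFun.quasiMeasurePreserving.ae hT, Φ.left_inv]
      with z hz hz'
    rw [hz, Function.comp_apply, Function.comp_apply, hz']
  refine ⟨T, fun n => ?_⟩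
  induction n with
  | zero => exact .of_forall fun z => rfl
  | succ n ih =>
    filter_upwards [ih, (σ.2.1.iterate n).quasiMeasurePreserving.ae hTΦ] with z hz hz'
    rw [Function.iterate_succ_apply', ← hz', ← hz, pow_succ']
    rfl

variable [StandardBorelSpace X] [StandardBorelSpace Z] [IsProbabilityMeasure μ]
  [IsProbabilityMeasure ν] [NullSingletonClass μ] [NullSingletonClass ν]

theorem exists_aeIso_mem_iff {π : Z → X} (hπ : MeasurePreserving π ν μ) {κ : Type*} [Finite κ]
    {A : κ → Set X} (hA : ∀ k, MeasurableSet (A k)) :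
    ∃ Φ : AEIso ν μ, ∀ᵐ z ∂ν, ∀ k, Φ.toFun z ∈ A k ↔ π z ∈ A k := by
  obtain ⟨c, hc, hS⟩ := exists_measurable_nat_preimage_eq hA
  obtain ⟨Φ, hΦ⟩ := exists_aeIso_comp_eq (ν := ν) hc (hc.comp hπ.measurable)
    (by rw [← Measure.map_map hc hπ.measurable, hπ.map_eq])
  refine ⟨Φ, hΦ.mono fun z hz k => ?_⟩
  obtain ⟨S, hSk⟩ := hS k
  rw [← hSk, Set.mem_preimage, Set.mem_preimage, hz, Function.comp_apply]

theorem exists_corr_pow_eq_measureReal (σ : mpPerm ν) {π : Z → X} (hπ : MeasurePreserving π ν μ)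
    {κ : Type*} [Finite κ] {A : κ → Set X} (hA : ∀ k, MeasurableSet (A k)) :
    ∃ T : MPAut μ, ∀ (n : ℕ) (k l : κ), corr (A k) (A l) (T ^ n) =
      ν.real {z | π ((σ : Equiv.Perm Z)^[n] z) ∈ A k ∧ π z ∈ A l} := by
  obtain ⟨Φ, hΦ⟩ := exists_aeIso_mem_iff hπ hA
  obtain ⟨T, hT⟩ := Φ.exists_mpPerm_conj σ
  refine ⟨T, fun n k l => ?_⟩
  rw [← QuotientGroup.mk_pow, corr_mk, ← Φ.measurePreserving_toFun.measureReal_preimage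
    ((mpPerm.measurable (T ^ n) (hA k)).inter (hA l)).nullMeasurableSet]
  refine measureReal_congr ?_
  filter_upwards [hT n, hΦ, (σ.2.1.iterate n).quasiMeasurePreserving.ae hΦ] with z hTz hz hσz
  refine propext (and_congr ?_ (hz l))
  rw [Set.mem_preimage, hTz, hσz]

end Conjugation

section FiniteModel

/-- A finite family of copies of `(Y, ρ)`, of masses `weight i`, permuted by `perm` and mapped to
`(X, μ)` by `proj`. It encodes the automorphism `perm × id` of a non-atomic space together with a
measure-preserving, not necessarily equivariant map to `X`. -/
structure FiniteModel {X Y : Type*} [MeasurableSpace X] [MeasurableSpace Y] (ρ : Measure Y)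
    (μ : Measure X) (I : Type*) [Fintype I] where
  weight : I → ℝ
  weight_nonneg : ∀ i, 0 ≤ weight i
  sum_weight : ∑ i, weight i = 1
  perm : Equiv.Perm I
  weight_perm : ∀ i, weight (perm i) = weight i
  proj : I → Y → X
  measurePreserving_proj : ∀ i, MeasurePreserving (proj i) ρ μ

namespace FiniteModel

variable {X Y : Type*} [MeasurableSpace X] [MeasurableSpace Y] {ρ : Measure Y} {μ : Measure X}
  {I J : Type*} [Fintype I] [Fintype J]

/-- The probability that the stationary process defined by a model is in `B` at time `0` and in
`A` at time `n`. -/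
def corr (M : FiniteModel ρ μ I) (n : ℕ) (A B : Set X) : ℝ :=
  ∑ i, M.weight i * ρ.real (M.proj (M.perm^[n] i) ⁻¹' A ∩ M.proj i ⁻¹' B)

/-- The disjoint union of two models, with masses scaled by `a` and `b`. -/
def mix (M : FiniteModel ρ μ I) (N : FiniteModel ρ μ J) {a b : ℝ} (ha : 0 ≤ a) (hb : 0 ≤ b)
    (hab : a + b = 1) : FiniteModel ρ μ (I ⊕ J) where
  weight := Sum.elim (a • M.weight) (b • N.weight)
  weight_nonneg := Sum.rec (fun i => mul_nonneg ha (M.weight_nonneg i))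
    fun j => mul_nonneg hb (N.weight_nonneg j)
  sum_weight := by
    simp only [Fintype.sum_sum_type, Sum.elim_inl, Sum.elim_inr, Pi.smul_apply, smul_eq_mul,
      ← Finset.mul_sum, sum_weight, mul_one, hab]
  perm := Equiv.sumCongr M.perm N.perm
  weight_perm := Sum.rec (fun i => congrArg (a * ·) (M.weight_perm i))
    fun j => congrArg (b * ·) (N.weight_perm j)
  proj := Sum.elim M.proj N.proj
  measurePreserving_proj := Sum.rec M.measurePreserving_proj N.measurePreserving_proj

theorem corr_mix (M : FiniteModel ρ μ I) (N : FiniteModel ρ μ J) {a b : ℝ} (ha : 0 ≤ a)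
    (hb : 0 ≤ b) (hab : a + b = 1) : (M.mix N ha hb hab).corr = a • M.corr + b • N.corr := by
  funext n A B
  have hl : Function.Semiconj Sum.inl M.perm (Equiv.sumCongr M.perm N.perm) := fun _ => rfl
  have hr : Function.Semiconj Sum.inr N.perm (Equiv.sumCongr M.perm N.perm) := fun _ => rfl
  simp only [corr, mix, Fintype.sum_sum_type,
    ← (hl.iterate_right n).eq, ← (hr.iterate_right n).eq,
    Sum.elim_inl, Sum.elim_inr, Pi.smul_apply, Pi.add_apply, smul_eq_mul, Finset.mul_sum,
    mul_assoc]

/-- The law of the index of a model. -/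
def indexMeasure [MeasurableSpace I] (M : FiniteModel ρ μ I) : Measure I :=
  ∑ i, ENNReal.ofReal (M.weight i) • Measure.dirac i

variable [MeasurableSpace I]

instance (M : FiniteModel ρ μ I) : IsProbabilityMeasure M.indexMeasure where
  measure_univ := by
    simp [indexMeasure, ← ENNReal.ofReal_sum_of_nonneg fun i _ => M.weight_nonneg i, M.sum_weight]

variable [DiscreteMeasurableSpace I]

theorem measurePreserving_of_weight_eq (M : FiniteModel ρ μ I)
    {τ : Equiv.Perm I} (hτ : ∀ i, M.weight (τ i) = M.weight i) :
    MeasurePreserving τ M.indexMeasure M.indexMeasure := by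
  refine ⟨.of_discrete, Measure.ext fun s hs => ?_⟩
  rw [Measure.map_apply .of_discrete hs]
  simp only [indexMeasure, Measure.coe_finsetSum, Finset.sum_apply, Measure.smul_apply,
    smul_eq_mul, Measure.dirac_apply]
  exact Fintype.sum_equiv τ _ _ fun i => by rw [hτ]; rfl

theorem measurable_uncurry_proj (M : FiniteModel ρ μ I) :
    Measurable fun z : I × Y => M.proj z.1 z.2 :=
  measurable_from_prod_countable_right fun i => (M.measurePreserving_proj i).measurable

variable [IsProbabilityMeasure ρ]

theorem measureReal_indexMeasure_prod (M : FiniteModel ρ μ I) {E : Set (I × Y)}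
    (hE : MeasurableSet E) :
    (M.indexMeasure.prod ρ).real E = ∑ i, M.weight i * ρ.real (Prod.mk i ⁻¹' E) := by
  rw [measureReal_def, Measure.prod_apply hE, indexMeasure, lintegral_finsetSum_measure]
  simp only [lintegral_smul_measure, lintegral_dirac, smul_eq_mul]
  rw [ENNReal.toReal_sum fun i _ => by finiteness]
  simp only [ENNReal.toReal_mul, ENNReal.toReal_ofReal (M.weight_nonneg _), measureReal_def]

theorem measurePreserving_uncurry_proj [IsFiniteMeasure μ] (M : FiniteModel ρ μ I) :
    MeasurePreserving (fun z : I × Y => M.proj z.1 z.2) (M.indexMeasure.prod ρ) μ := by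
  refine ⟨M.measurable_uncurry_proj, Measure.ext fun B hB => ?_⟩
  rw [Measure.map_apply M.measurable_uncurry_proj hB,
    ← ENNReal.toReal_eq_toReal_iff' (measure_ne_top _ _) (measure_ne_top _ _), ← measureReal_def,
    M.measureReal_indexMeasure_prod (M.measurable_uncurry_proj hB)]
  have hfiber (i : I) : ρ.real (M.proj i ⁻¹' B) = μ.real B :=
    (M.measurePreserving_proj i).measureReal_preimage hB.nullMeasurableSet
  simp only [Set.preimage_preimage, hfiber, ← Finset.sum_mul, M.sum_weight, one_mul,
    measureReal_def]

/-- The automorphism `perm × id` of a model. -/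
def shift (M : FiniteModel ρ μ I) : mpPerm (M.indexMeasure.prod ρ) :=
  ⟨M.perm.prodCongr (.refl Y),
    (M.measurePreserving_of_weight_eq M.weight_perm).prod (.id ρ),
    (M.measurePreserving_of_weight_eq fun i => by
      rw [← M.weight_perm, Equiv.apply_symm_apply]).prod (.id ρ)⟩

theorem iterate_shift (M : FiniteModel ρ μ I) (n : ℕ) (z : I × Y) :
    (M.shift : Equiv.Perm (I × Y))^[n] z = (M.perm^[n] z.1, z.2) := by
  change (Prod.map M.perm id)^[n] z = _
  rw [Prod.map_iterate, Function.iterate_id]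
  rfl

end FiniteModel

variable {X Y : Type*} [MeasurableSpace X] [MeasurableSpace Y] [StandardBorelSpace X]
  [StandardBorelSpace Y] {ρ : Measure Y} {μ : Measure X} [IsProbabilityMeasure ρ]
  [IsProbabilityMeasure μ] [NullSingletonClass ρ] [NullSingletonClass μ]

theorem FiniteModel.exists_corr_pow_eq {I : Type*} [Fintype I] (M : FiniteModel ρ μ I)
    {κ : Type*} [Finite κ] {A : κ → Set X} (hA : ∀ k, MeasurableSet (A k)) :
    ∃ T : MPAut μ, ∀ n k l, WeakLimits.corr (A k) (A l) (T ^ n) = M.corr n (A k) (A l) := by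
  let : MeasurableSpace I := ⊤
  have : DiscreteMeasurableSpace I := ⟨fun _ => trivial⟩
  obtain ⟨T, hT⟩ := exists_corr_pow_eq_measureReal M.shift M.measurePreserving_uncurry_proj hA
  refine ⟨T, fun n k l => ?_⟩
  have hproj := M.measurable_uncurry_proj
  have hE : MeasurableSet {z : I × Y |
      M.proj ((M.shift : Equiv.Perm (I × Y))^[n] z).1
        ((M.shift : Equiv.Perm (I × Y))^[n] z).2 ∈ A k ∧ M.proj z.1 z.2 ∈ A l} :=
    ((hproj.comp (M.shift.2.1.measurable.iterate n)) (hA k)).inter (hproj (hA l))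
  rw [hT, M.measureReal_indexMeasure_prod hE]
  simp only [FiniteModel.iterate_shift]
  rfl

end FiniteModel

section Cycle

theorem val_add_intCast_of_nonneg_of_lt {n : ℕ} [NeZero n] {k : ZMod n} {j : ℤ}
    (h0 : 0 ≤ (k.val : ℤ) + j) (hn : (k.val : ℤ) + j < n) :
    ((k + j : ZMod n).val : ℤ) = k.val + j := by
  rw [show (k + j : ZMod n) = ((k.val + j : ℤ) : ZMod n) by simp, ZMod.val_intCast,
    Int.emod_eq_of_lt h0 hn]

theorem card_filter_val_add_intCast_ne_le {n : ℕ} [NeZero n] (j : ℤ) :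
    (Finset.univ.filter fun k : ZMod n => ((k + j : ZMod n).val : ℤ) ≠ k.val + j).card ≤
      j.natAbs := by
  have hmaps : ∀ k ∈ Finset.univ.filter fun k : ZMod n =>
      ((k + j : ZMod n).val : ℤ) ≠ k.val + j,
      (k.val : ℤ) ∈ Finset.Ico ((n : ℤ) - j) n ∪ Finset.Ico 0 (-j) := fun k hk => by
    have hlt := ZMod.val_lt k
    have hwrap := mt (fun h : 0 ≤ (k.val : ℤ) + j ∧ (k.val : ℤ) + j < n =>
      val_add_intCast_of_nonneg_of_lt h.1 h.2) (Finset.mem_filter.1 hk).2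
    simp only [Finset.mem_union, Finset.mem_Ico]
    omega
  calc _ ≤ (Finset.Ico ((n : ℤ) - j) n ∪ Finset.Ico 0 (-j)).card :=
        Finset.card_le_card_of_injOn _ hmaps fun k _ l _ h =>
          ZMod.val_injective n (Int.ofNat.inj h)
    _ ≤ (Finset.Ico ((n : ℤ) - j) n).card + (Finset.Ico 0 (-j)).card := Finset.card_union_le _ _
    _ ≤ j.natAbs := by
      rw [Int.card_Ico, Int.card_Ico]
      omega

theorem val_add_natCast_lt_iff_not {m : ℕ} [NeZero m] (k : ZMod (2 * m)) :
    (k + m : ZMod (2 * m)).val < m ↔ ¬ k.val < m := by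
  have hm := NeZero.pos m
  have hk := ZMod.val_lt k
  rw [ZMod.val_add, ZMod.val_natCast, Nat.mod_eq_of_lt (by omega : m < 2 * m)]
  rcases lt_or_ge (k.val + m) (2 * m) with h | h
  · rw [Nat.mod_eq_of_lt h]
    omega
  · rw [Nat.mod_eq_sub_mod h, Nat.mod_eq_of_lt (by omega)]
    omega

theorem abs_average_sub_le {ι : Type*} [Fintype ι] [Nonempty ι] {f : ι → ℝ} {y : ℝ}
    (s : Finset ι) (hs : ∀ i ∉ s, f i = y) (hf : ∀ i, |f i - y| ≤ 1) :
    |(Fintype.card ι : ℝ)⁻¹ * ∑ i, f i - y| ≤ s.card / Fintype.card ι := by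
  have hcard : (0 : ℝ) < Fintype.card ι := by exact_mod_cast Fintype.card_pos
  have hsum : (Fintype.card ι : ℝ)⁻¹ * ∑ i, f i - y =
      (Fintype.card ι : ℝ)⁻¹ * ∑ i ∈ s, (f i - y) := by
    rw [Finset.sum_subset s.subset_univ fun i _ hi => sub_eq_zero.2 (hs i hi),
      Finset.sum_sub_distrib, Finset.sum_const, Finset.card_univ, nsmul_eq_mul, mul_sub,
      inv_mul_cancel_left₀ hcard.ne']
  rw [hsum, abs_mul, abs_of_pos (inv_pos.2 hcard), inv_mul_eq_div]
  gcongr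
  calc |∑ i ∈ s, (f i - y)| ≤ ∑ i ∈ s, |f i - y| := Finset.abs_sum_le_sum_abs _ _
    _ ≤ s.card := by simpa using Finset.sum_le_card_nsmul s _ 1 fun i _ => hf i

end Cycle

section OrbitCycle

variable {X Y : Type*} [MeasurableSpace X] [MeasurableSpace Y] {μ : Measure X} {ρ : Measure Y}

/-- The cyclic model of length `n` that follows the orbits of `T`: level `k` is mapped to `X` by
`T ^ k ∘ side k`. When `side` is constant this is a tower over `X` whose only defect, of measure
`1 / n`, is at its top. -/
def orbitCycle (T : mpPerm μ) (n : ℕ) [NeZero n] {side : ZMod n → Y → X}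
    (hside : ∀ k, MeasurePreserving (side k) ρ μ) : FiniteModel ρ μ (ZMod n) where
  weight _ := (n : ℝ)⁻¹
  weight_nonneg _ := by positivity
  sum_weight := by simp [NeZero.ne n]
  perm := Equiv.addRight 1
  weight_perm _ := rfl
  proj k y := ((T ^ k.val : mpPerm μ) : Equiv.Perm X) (side k y)
  measurePreserving_proj k := (T ^ k.val).2.1.comp (hside k)

variable (T : mpPerm μ) {n : ℕ} [NeZero n] {side : ZMod n → Y → X}
  (hside : ∀ k, MeasurePreserving (side k) ρ μ)

theorem corr_orbitCycle (q : ℕ) (A B : Set X) : (orbitCycle T n hside).corr q A B =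
    (Fintype.card (ZMod n) : ℝ)⁻¹ * ∑ k : ZMod n, ρ.real
      (side (k + q) ⁻¹' (((T ^ (k + q).val : mpPerm μ) : Equiv.Perm X) ⁻¹' A) ∩
        side k ⁻¹' (((T ^ k.val : mpPerm μ) : Equiv.Perm X) ⁻¹' B)) := by
  have hiter (k : ZMod n) : (orbitCycle T n hside).perm^[q] k = k + q := by
    change (· + (1 : ZMod n))^[q] k = k + q
    rw [add_right_iterate, nsmul_one]
  simp only [FiniteModel.corr, hiter, Finset.mul_sum, ZMod.card]
  rfl

variable [IsProbabilityMeasure μ] [IsProbabilityMeasure ρ]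

theorem abs_corr_orbitCycle_sub_le {q : ℕ} {j : ℤ} (hqj : (q : ZMod n) = j) (s : Finset (ZMod n))
    (hs : ∀ k ∉ s, ((k + j : ZMod n).val : ℤ) = k.val + j → side (k + j) = side k)
    {A B : Set X} (hA : MeasurableSet A) (hB : MeasurableSet B) :
    |(orbitCycle T n hside).corr q A B - corr A B ((T : MPAut μ) ^ j)| ≤
      (s.card + j.natAbs : ℕ) / n := by
  classical
  rw [corr_orbitCycle, hqj]
  refine (abs_average_sub_le (s ∪ Finset.univ.filter fun k : ZMod n =>
    ((k + j : ZMod n).val : ℤ) ≠ k.val + j) (fun k hk => ?_) fun k => ?_).trans ?_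
  · simp only [Finset.mem_union, Finset.mem_filter_univ, not_or, not_not] at hk
    rw [hs k hk.1 hk.2, ← Set.preimage_inter, (hside k).measureReal_preimage
        ((mpPerm.measurable _ hA).inter (mpPerm.measurable _ hB)).nullMeasurableSet,
      corr_zpow_eq_of_natCast_eq_add hA hB T hk.2]
  · exact abs_sub_le_of_nonneg_of_le measureReal_nonneg measureReal_le_one (corr_nonneg _ _ _)
      (corr_le_one _ _ _)
  · rw [ZMod.card]
    gcongr
    exact (Finset.card_union_le _ _).trans
      (add_le_add_right (card_filter_val_add_intCast_ne_le j) _)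

theorem abs_corr_orbitCycle_const_sub_le {π : Y → X} (hπ : MeasurePreserving π ρ μ) {q : ℕ}
    {j : ℤ} (hqj : (q : ZMod n) = j) {A B : Set X} (hA : MeasurableSet A)
    (hB : MeasurableSet B) :
    |(orbitCycle T n fun _ => hπ).corr q A B - corr A B ((T : MPAut μ) ^ j)| ≤ j.natAbs / n := by
  simpa using abs_corr_orbitCycle_sub_le T (fun _ => hπ) hqj ∅ (fun _ _ _ => rfl) hA hB

end OrbitCycle

section DoubleCycle

variable {X : Type*} [MeasurableSpace X] {μ : Measure X} [IsProbabilityMeasure μ]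

/-- The first coordinate on the lower half of a cycle of length `2 * m` and the second one on the
upper half: in the corresponding `orbitCycle` the states at times `0` and `m` are independent. -/
def halfProj (X : Type*) (m : ℕ) (k : ZMod (2 * m)) : X × X → X :=
  if k.val < m then Prod.fst else Prod.snd

theorem measurePreserving_halfProj {m : ℕ} (k : ZMod (2 * m)) :
    MeasurePreserving (halfProj X m k) (μ.prod μ) μ := by
  unfold halfProj
  split_ifs
  exacts [measurePreserving_fst, measurePreserving_snd]

variable (T : mpPerm μ) {m : ℕ} [NeZero m] {A B : Set X}

theorem corr_orbitCycle_halfProj_self (hA : MeasurableSet A) (hB : MeasurableSet B) :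
    (orbitCycle T (2 * m) measurePreserving_halfProj).corr m A B = μ.real A * μ.real B := by
  have hprod {A B : Set X} (hA : MeasurableSet A) (hB : MeasurableSet B) (U V : mpPerm μ) :
      (μ.prod μ).real (Prod.fst ⁻¹' ((U : Equiv.Perm X) ⁻¹' A) ∩
        Prod.snd ⁻¹' ((V : Equiv.Perm X) ⁻¹' B)) = μ.real A * μ.real B := by
    rw [← Set.prod_eq, measureReal_prod_prod, mpPerm.measureReal_preimage U hA,
      mpPerm.measureReal_preimage V hB]
  have hcard : (Fintype.card (ZMod (2 * m)) : ℝ) ≠ 0 := by exact_mod_cast Fintype.card_ne_zero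
  rw [corr_orbitCycle, Finset.sum_congr rfl fun k _ => ?_, Finset.sum_const, Finset.card_univ,
    nsmul_eq_mul, inv_mul_cancel_left₀ hcard]
  by_cases hk : k.val < m
  · rw [halfProj, halfProj, if_neg fun h => (val_add_natCast_lt_iff_not k).1 h hk, if_pos hk,
      Set.inter_comm, hprod hB hA, mul_comm]
  · rw [halfProj, halfProj, if_pos ((val_add_natCast_lt_iff_not k).2 hk), if_neg hk, hprod hA hB]

theorem abs_corr_orbitCycle_halfProj_one_sub_le (hA : MeasurableSet A) (hB : MeasurableSet B) :
    |(orbitCycle T (2 * m) measurePreserving_halfProj).corr 1 A B - corr A B (T : MPAut μ)| ≤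
      1 / m := by
  have hm := NeZero.pos m
  have hside (k : ZMod (2 * m)) (hk : k ∉ ({((m - 1 : ℕ) : ZMod (2 * m))} : Finset (ZMod (2 * m))))
      (hval : ((k + (1 : ℤ) : ZMod (2 * m)).val : ℤ) = k.val + 1) :
      halfProj X m (k + (1 : ℤ)) = halfProj X m k := by
    have hne : k.val ≠ m - 1 := fun h =>
      hk (by rw [← h, ZMod.natCast_zmod_val, Finset.mem_singleton])
    unfold halfProj
    exact if_congr (by omega) rfl rfl
  have hle := abs_corr_orbitCycle_sub_le T measurePreserving_halfProj (q := 1) (j := 1) (by simp) _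
    hside hA hB
  rw [zpow_one] at hle
  refine hle.trans_eq ?_
  push_cast [Finset.card_singleton]
  field_simp

end DoubleCycle

section Approximation

variable {X : Type*} [MeasurableSpace X] {μ : Measure X}

theorem abs_convexComb_sub_le {a b x y u v ε : ℝ} (ha : 0 ≤ a) (hb : 0 ≤ b) (hab : a + b = 1)
    (hx : |x - u| ≤ ε) (hy : |y - v| ≤ ε) : |(a * x + b * y) - (a * u + b * v)| ≤ ε :=
  calc |(a * x + b * y) - (a * u + b * v)| = |a * (x - u) + b * (y - v)| := by ring_nf
    _ ≤ a * |x - u| + b * |y - v| := by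
      simpa only [abs_mul, abs_of_nonneg ha, abs_of_nonneg hb] using
        abs_add_le (a * (x - u)) (b * (y - v))
    _ ≤ a * ε + b * ε := by gcongr
    _ = ε := by rw [← add_mul, hab, one_mul]

/-- The correlation functions of the finite models of `μ` over `μ.prod μ`. -/
def modelCorr (μ : Measure X) : Set (ℕ → Set X → Set X → ℝ) :=
  {c | ∃ (I : Type) (_ : Fintype I) (M : FiniteModel (μ.prod μ) μ I), M.corr = c}

theorem convex_modelCorr : Convex ℝ (modelCorr μ) := by
  rintro _ ⟨I, _, M, rfl⟩ _ ⟨J, _, N, rfl⟩ a b ha hb hab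
  exact ⟨I ⊕ J, inferInstance, M.mix N ha hb hab, M.corr_mix N ha hb hab⟩

/-- The correlations `V` that, for all large `m`, are close to those of the `m`-th power of a finite
model close to `T`. -/
def nearbyPowerLimits (T : MPAut μ) : Set (Set X → Set X → ℝ) :=
  {V | ∀ ε > 0, ∀ᶠ m in atTop, ∃ c ∈ modelCorr μ, ∀ A B, MeasurableSet A → MeasurableSet B →
    |c 1 A B - corr A B T| ≤ ε ∧ |c m A B - V A B| ≤ ε}

theorem convex_nearbyPowerLimits (T : MPAut μ) : Convex ℝ (nearbyPowerLimits T) := by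
  intro V hV W hW a b ha hb hab ε hε
  filter_upwards [hV ε hε, hW ε hε] with m ⟨c, hc, hcV⟩ ⟨d, hd, hdW⟩
  refine ⟨a • c + b • d, convex_modelCorr hc hd ha hb hab, fun A B hA hB => ⟨?_, ?_⟩⟩
  · have := abs_convexComb_sub_le ha hb hab (hcV A B hA hB).1 (hdW A B hA hB).1
    rwa [← add_mul, hab, one_mul] at this
  · exact abs_convexComb_sub_le ha hb hab (hcV A B hA hB).2 (hdW A B hA hB).2

theorem mem_nearbyPowerLimits_of_forall_exists_abs_sub_le {T : MPAut μ} {V : Set X → Set X → ℝ}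
    (h : ∀ ε > 0, ∃ W ∈ nearbyPowerLimits T, ∀ A B, |W A B - V A B| ≤ ε) :
    V ∈ nearbyPowerLimits T := by
  intro ε hε
  obtain ⟨W, hW, hWV⟩ := h (ε / 2) (by positivity)
  filter_upwards [hW (ε / 2) (by positivity)] with m ⟨c, hc, hcW⟩
  refine ⟨c, hc, fun A B hA hB => ⟨(hcW A B hA hB).1.trans (by linarith), ?_⟩⟩
  linarith [abs_sub_le (c m A B) (W A B) (V A B), (hcW A B hA hB).2, hWV A B]

variable [IsProbabilityMeasure μ]

theorem corr_zpow_mem_nearbyPowerLimits (T : MPAut μ) (j : ℤ) :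
    (fun A B => corr A B (T ^ j)) ∈ nearbyPowerLimits T := by
  induction T using QuotientGroup.induction_on with | H T => ?_
  intro ε hε
  obtain ⟨N, hN⟩ := exists_nat_gt ((j.natAbs + 1) / ε)
  filter_upwards [eventually_ge_atTop (N + j.natAbs)] with m hm
  obtain ⟨n, hn⟩ : ∃ n : ℕ, (n : ℤ) = m - j := ⟨((m : ℤ) - j).toNat, by omega⟩
  have hNn : (N : ℝ) ≤ n := by
    have : N ≤ n := by omega
    exact_mod_cast this
  have hn0 : (0 : ℝ) < n := (by positivity : (0 : ℝ) ≤ _).trans_lt (hN.trans_le hNn)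
  have : NeZero n := ⟨by exact_mod_cast hn0.ne'⟩
  have hjn : ((j.natAbs : ℝ) + 1) / n ≤ ε :=
    (div_le_comm₀ hn0 hε).2 (hN.le.trans hNn)
  have hmj : (m : ZMod n) = j := by
    have := congrArg (Int.cast : ℤ → ZMod n) hn
    push_cast [ZMod.natCast_self] at this
    exact sub_eq_zero.1 this.symm
  refine ⟨_, ⟨ZMod n, inferInstance, orbitCycle T n fun _ => measurePreserving_fst, rfl⟩,
    fun A B hA hB => ⟨?_, ?_⟩⟩
  · have hle := abs_corr_orbitCycle_const_sub_le T measurePreserving_fst (q := 1) (n := n)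
      (j := 1) (ρ := μ.prod μ) (by simp) hA hB
    rw [zpow_one] at hle
    refine hle.trans (le_trans ?_ hjn)
    gcongr
    simp
  · refine (abs_corr_orbitCycle_const_sub_le T measurePreserving_fst hmj hA hB).trans
      (le_trans ?_ hjn)
    gcongr
    simp

theorem measureReal_mul_mem_nearbyPowerLimits (T : MPAut μ) :
    (fun A B => μ.real A * μ.real B) ∈ nearbyPowerLimits T := by
  induction T using QuotientGroup.induction_on with | H T => ?_
  intro ε hε
  filter_upwards [eventually_gt_atTop 0,
    (tendsto_one_div_atTop_nhds_zero_nat (𝕜 := ℝ)).eventually_le_const hε] with m hm hmε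
  have : NeZero m := ⟨hm.ne'⟩
  refine ⟨_, ⟨ZMod (2 * m), inferInstance, orbitCycle T (2 * m) measurePreserving_halfProj, rfl⟩,
    fun A B hA hB => ⟨?_, ?_⟩⟩
  · exact (abs_corr_orbitCycle_halfProj_one_sub_le T hA hB).trans hmε
  · rw [corr_orbitCycle_halfProj_self T hA hB, sub_self, abs_zero]
    exact hε.le

/-- The correlation `⟨R(T) 1_A, 1_B⟩ = a μ(A) μ(B) + ∑ᵢ aᵢ μ(T⁻ⁱA ∩ B)` along an admissible
function. -/
def Admissible.corr (R : Admissible) (A B : Set X) (T : MPAut μ) : ℝ :=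
  R.a * (μ.real A * μ.real B) + ∑' i : ℤ, R.coeff i * WeakLimits.corr A B (T ^ i)

theorem Admissible.summable_corr (R : Admissible) (A B : Set X) (T : MPAut μ) :
    Summable fun i : ℤ => R.coeff i * WeakLimits.corr A B (T ^ i) :=
  .of_nonneg_of_le (fun i => mul_nonneg (R.coeff_nonneg i) (corr_nonneg _ _ _))
    (fun i => mul_le_of_le_one_right (R.coeff_nonneg i) (corr_le_one _ _ _)) R.hasSum.summable

theorem Admissible.continuous_corr (R : Admissible) {A B : Set X}
    (hA : MeasurableSet A) (hB : MeasurableSet B) :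
    Continuous fun T : MPAut μ => R.corr A B T := by
  refine continuous_const.add (continuous_tsum (fun i => continuous_const.mul
    ((WeakLimits.continuous_corr hA hB).comp (continuous_zpow i))) R.hasSum.summable
    fun i T => ?_)
  rw [Real.norm_eq_abs, abs_of_nonneg (mul_nonneg (R.coeff_nonneg i) (corr_nonneg _ _ _))]
  exact mul_le_of_le_one_right (R.coeff_nonneg i) (corr_le_one _ _ _)

theorem Admissible.sum_coeff_le (R : Admissible) (S : Finset ℤ) :
    ∑ i ∈ S, R.coeff i ≤ 1 - R.a :=
  sum_le_hasSum S (fun i _ => R.coeff_nonneg i) R.hasSum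

theorem Admissible.abs_finsetSum_sub_corr_le (R : Admissible) (S : Finset ℤ) (A B : Set X)
    (T : MPAut μ) :
    |((1 - ∑ i ∈ S, R.coeff i) * (μ.real A * μ.real B) +
        ∑ i ∈ S, R.coeff i * WeakLimits.corr A B (T ^ i)) - R.corr A B T| ≤
      1 - R.a - ∑ i ∈ S, R.coeff i := by
  have hsummable := R.summable_corr A B T
  have hlower := hsummable.sum_le_tsum S fun i _ =>
    mul_nonneg (R.coeff_nonneg i) (corr_nonneg A B (T ^ i))
  have hupper := (R.hasSum.summable.sub hsummable).sum_le_tsum S fun i _ =>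
    sub_nonneg.2 (mul_le_of_le_one_right (R.coeff_nonneg i) (corr_le_one A B (T ^ i)))
  rw [Finset.sum_sub_distrib, R.hasSum.summable.tsum_sub hsummable, R.hasSum.tsum_eq] at hupper
  have hprod : μ.real A * μ.real B ≤ 1 :=
    mul_le_one₀ measureReal_le_one measureReal_nonneg measureReal_le_one
  have hrest := sub_nonneg.2 (R.sum_coeff_le S)
  have hrest_le := mul_le_mul_of_nonneg_left hprod hrest
  have hrest_nonneg : 0 ≤ (1 - R.a - ∑ i ∈ S, R.coeff i) * (μ.real A * μ.real B) := by
    positivity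
  rw [Admissible.corr, abs_le]
  constructor <;> linarith

theorem Admissible.corr_mem_nearbyPowerLimits (R : Admissible) (T : MPAut μ) :
    (fun A B => R.corr A B T) ∈ nearbyPowerLimits T := by
  refine mem_nearbyPowerLimits_of_forall_exists_abs_sub_le fun ε hε => ?_
  obtain ⟨S, hS⟩ := (R.hasSum.eventually_const_lt (sub_lt_self _ hε)).exists
  let weight : Option ℤ → ℝ := fun o => o.elim (1 - ∑ i ∈ S, R.coeff i) R.coeff
  let limit : Option ℤ → Set X → Set X → ℝ := fun o =>
    o.elim (fun A B => μ.real A * μ.real B) fun i A B => WeakLimits.corr A B (T ^ i)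
  have hmem := (convex_nearbyPowerLimits T).sum_mem (t := S.insertNone) (w := weight) (z := limit)
    ?_ ?_ ?_
  · refine ⟨_, hmem, fun A B => ?_⟩
    simp only [Finset.sum_apply, Finset.sum_insertNone, Pi.smul_apply, smul_eq_mul]
    exact (R.abs_finsetSum_sub_corr_le S A B T).trans (by linarith)
  · rintro (_ | i) -
    · exact sub_nonneg.2 ((R.sum_coeff_le S).trans (sub_le_self _ R.a_nonneg))
    · exact R.coeff_nonneg i
  · rw [Finset.sum_insertNone]
    exact sub_add_cancel _ _
  · rintro (_ | i) -
    · exact measureReal_mul_mem_nearbyPowerLimits T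
    · exact corr_zpow_mem_nearbyPowerLimits T i

theorem Admissible.eventually_exists_abs_corr_sub_le [StandardBorelSpace X]
    [NullSingletonClass μ] (R : Admissible) (T : MPAut μ) {κ : Type*} [Finite κ] {A : κ → Set X}
    (hA : ∀ k, MeasurableSet (A k)) {ε : ℝ} (hε : 0 < ε) :
    ∀ᶠ m : ℕ in atTop, ∃ U : MPAut μ, ∀ k l,
      |WeakLimits.corr (A k) (A l) U - WeakLimits.corr (A k) (A l) T| ≤ ε ∧
      |WeakLimits.corr (A k) (A l) (U ^ m) - R.corr (A k) (A l) T| ≤ ε := by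
  filter_upwards [R.corr_mem_nearbyPowerLimits T ε hε] with m ⟨c, ⟨I, _, M, hM⟩, hc⟩
  obtain ⟨U, hU⟩ := M.exists_corr_pow_eq hA
  refine ⟨U, fun k l => ?_⟩
  have hone := hU 1 k l
  rw [pow_one, hM] at hone
  rw [hone, hU m k l, hM]
  exact hc _ _ (hA k) (hA l)

end Approximation

section BoundedOperators

variable {ι 𝕜 E F : Type*} [NontriviallyNormedField 𝕜] [SeminormedAddCommGroup E]
  [NormedSpace 𝕜 E] [SeminormedAddCommGroup F] [NormedSpace 𝕜 F]

theorem tendsto_apply_of_dense_span {l : Filter ι} {φ : ι → E →L[𝕜] F} {φ₀ : E →L[𝕜] F} {K : ℝ}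
    (hφ : ∀ a, ‖φ a‖ ≤ K) {s : Set E} (hs : (Submodule.span 𝕜 s).topologicalClosure = ⊤)
    (h : ∀ x ∈ s, Tendsto (fun a => φ a x) l (𝓝 (φ₀ x))) (x : E) :
    Tendsto (fun a => φ a x) l (𝓝 (φ₀ x)) := by
  let convergenceSpace : Submodule 𝕜 E :=
    { carrier := {x | Tendsto (fun a => φ a x) l (𝓝 (φ₀ x))}
      zero_mem' := by simp [tendsto_const_nhds]
      add_mem' := fun hx hy => by simpa using hx.add hy
      smul_mem' := fun c _ hx => by simpa using Tendsto.const_smul hx c }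
  have equicontinuous_φ : Equicontinuous fun a => ⇑(φ a) :=
    (LipschitzWith.uniformEquicontinuous _ K.toNNReal fun a =>
      (φ a).lipschitzWith_of_opNorm_le ((hφ a).trans (Real.le_coe_toNNReal K))).equicontinuous
  have isClosed_convergenceSpace : IsClosed (convergenceSpace : Set E) :=
    equicontinuous_φ.isClosed_setOfPred_tendsto φ₀.continuous
  have : (⊤ : Submodule 𝕜 E) ≤ convergenceSpace :=
    hs ▸ Submodule.topologicalClosure_minimal _ (Submodule.span_le.2 h) isClosed_convergenceSpace
  exact this Submodule.mem_top

theorem tendsto_inner_apply_of_dense_span {ι 𝕜 E : Type*} [RCLike 𝕜] [SeminormedAddCommGroup E]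
    [InnerProductSpace 𝕜 E] {l : Filter ι} {V : ι → E →L[𝕜] E} {W : E →L[𝕜] E} {K : ℝ}
    (hV : ∀ a, ‖V a‖ ≤ K) {s : Set E} (hs : (Submodule.span 𝕜 s).topologicalClosure = ⊤)
    (h : ∀ x ∈ s, ∀ y ∈ s, Tendsto (fun a => inner 𝕜 y (V a x)) l (𝓝 (inner 𝕜 y (W x))))
    (x y : E) : Tendsto (fun a => inner 𝕜 y (V a x)) l (𝓝 (inner 𝕜 y (W x))) := by
  have tendsto_right : ∀ y ∈ s, ∀ x,
      Tendsto (fun a => inner 𝕜 y (V a x)) l (𝓝 (inner 𝕜 y (W x))) := fun y hy =>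
    tendsto_apply_of_dense_span (φ := fun a => innerSL 𝕜 y ∘L V a) (φ₀ := innerSL 𝕜 y ∘L W)
      (K := ‖y‖ * K)
      (fun a => (ContinuousLinearMap.opNorm_comp_le _ _).trans <| by
        rw [innerSL_apply_norm]; gcongr; exact hV a)
      hs fun x hx => h x hx y hy
  have tendsto_left : Tendsto (fun a => inner 𝕜 (V a x) y) l (𝓝 (inner 𝕜 (W x) y)) :=
    tendsto_apply_of_dense_span (φ := fun a => innerSL 𝕜 (V a x)) (φ₀ := innerSL 𝕜 (W x))
      (K := K * ‖x‖) (fun a => by rw [innerSL_apply_norm]; exact (V a).le_of_opNorm_le (hV a) x) hs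
      (fun y hy => by
        simpa [Function.comp_def] using
          (RCLike.continuous_conj.tendsto _).comp (tendsto_right y hy x)) y
  simpa [Function.comp_def] using (RCLike.continuous_conj.tendsto _).comp tendsto_left

end BoundedOperators

section Koopman

variable {X : Type*} [MeasurableSpace X] {μ : Measure X}

theorem norm_koopman_apply (T : MPAut μ) (f : L2 μ) : ‖koopman T f‖ = ‖f‖ := by
  induction T using Quotient.inductionOn' with | h T => ?_
  exact Lp.norm_compMeasurePreserving f (mpPerm.measurePreserving T)

theorem norm_koopman_le (T : MPAut μ) : ‖koopman T‖ ≤ 1 :=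
  ContinuousLinearMap.opNorm_le_bound _ zero_le_one fun f => by
    rw [norm_koopman_apply, one_mul]

theorem koopman_one : koopman (1 : MPAut μ) = ContinuousLinearMap.id ℂ (L2 μ) := by
  ext1 f
  exact Lp.compMeasurePreserving_id_apply f

theorem koopman_mul_apply (S T : MPAut μ) (f : L2 μ) :
    koopman (S * T) f = koopman T (koopman S f) := by
  induction S using Quotient.inductionOn' with | h S => ?_
  induction T using Quotient.inductionOn' with | h T => ?_
  exact Lp.compMeasurePreserving_comp_apply f (mpPerm.measurePreserving S)
    (mpPerm.measurePreserving T)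

theorem inner_koopman_koopman (T : MPAut μ) (f g : L2 μ) :
    inner ℂ (koopman T f) (koopman T g) = inner ℂ f g := by
  induction T using Quotient.inductionOn' with | h T => ?_
  exact (Lp.compMeasurePreservingₗᵢ ℂ (T : Equiv.Perm X)
    (mpPerm.measurePreserving T)).inner_map_map f g

theorem Admissible.summable_eval (R : Admissible) (T : MPAut μ) :
    Summable fun i : ℤ => (R.coeff i : ℂ) • koopman (T ^ i) := by
  refine Summable.of_norm_bounded R.hasSum.summable fun i => ?_
  rw [norm_smul, Complex.norm_real, Real.norm_of_nonneg (R.coeff_nonneg i)]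
  exact mul_le_of_le_one_right (R.coeff_nonneg i) (norm_koopman_le _)

theorem WeakLimitAlong.mono {M M' : Set ℕ} (h : M' ⊆ M) {T : MPAut μ} {V : L2 μ →L[ℂ] L2 μ}
    (hV : WeakLimitAlong M T V) : WeakLimitAlong M' T V :=
  Tendsto.mono_left hV (inf_le_inf_left _ (principal_mono.2 h))

theorem WeakLimitAlong.unique {M : Set ℕ} (hM : M.Infinite) {T : MPAut μ}
    {V W : L2 μ →L[ℂ] L2 μ} (hV : WeakLimitAlong M T V) (hW : WeakLimitAlong M T W) : V = W := by
  have : (atTop ⊓ 𝓟 M : Filter ℕ).NeBot :=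
    frequently_mem_iff_neBot.1 (Nat.frequently_atTop_iff_infinite.2 hM)
  exact ContinuousLinearMapWOT.ofCLM_injective (tendsto_nhds_unique hV hW)

variable [IsProbabilityMeasure μ]

/-- The indicator function of a set as an element of `L₂`. -/
def ind (μ : Measure X) [IsProbabilityMeasure μ] {A : Set X} (hA : MeasurableSet A) : L2 μ :=
  indicatorConstLp 2 hA (measure_ne_top μ A) 1

theorem indicatorConstLp_eq_smul_ind {A : Set X} (hA : MeasurableSet A) (c : ℂ) :
    indicatorConstLp 2 hA (measure_ne_top μ A) c = c • ind μ hA := by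
  rw [ind, indicatorConstLp, indicatorConstLp, ← MemLp.toLp_const_smul]
  congr 1
  ext x
  by_cases hx : x ∈ A <;> simp [hx]

theorem const_eq_ind : Lp.const 2 μ (1 : ℂ) = ind μ MeasurableSet.univ :=
  (indicatorConstLp_univ 2 μ (1 : ℂ)).symm

theorem koopman_ind_univ (T : MPAut μ) :
    koopman T (ind μ MeasurableSet.univ) = ind μ MeasurableSet.univ := by
  induction T using Quotient.inductionOn' with | h T => ?_
  exact Lp.indicatorConstLp_compMeasurePreserving _ _ _ (mpPerm.measurePreserving T)

theorem inner_ind_ind {A B : Set X} (hA : MeasurableSet A) (hB : MeasurableSet B) :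
    inner ℂ (ind μ hA) (ind μ hB) = (μ.real (A ∩ B) : ℂ) :=
  L2.inner_indicatorConstLp_one_indicatorConstLp_one hA hB

theorem inner_ind_koopman {A B : Set X} (hA : MeasurableSet A) (hB : MeasurableSet B)
    (T : MPAut μ) : inner ℂ (ind μ hB) (koopman T (ind μ hA)) = (corr A B T : ℂ) := by
  induction T using Quotient.inductionOn' with | h T => ?_
  have koopman_ind : koopman (Quotient.mk'' T) (ind μ hA) = ind μ (mpPerm.measurable T hA) :=
    Lp.indicatorConstLp_compMeasurePreserving hA _ _ (mpPerm.measurePreserving T)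
  rw [koopman_ind, inner_ind_ind, Set.inter_comm]
  rfl

theorem meanProj_apply (f : L2 μ) :
    meanProj μ f = inner ℂ (ind μ MeasurableSet.univ) f • ind μ MeasurableSet.univ := by
  rw [meanProj, ← const_eq_ind]
  refine Submodule.starProjection_unit_singleton ℂ ?_ f
  simp [Lp.norm_const (p := 2) (μ := μ) (c := (1 : ℂ)) two_ne_zero]

theorem inner_ind_meanProj {A B : Set X} (hA : MeasurableSet A) (hB : MeasurableSet B) :
    inner ℂ (ind μ hB) (meanProj μ (ind μ hA)) = ((μ.real A * μ.real B : ℝ) : ℂ) := by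
  rw [meanProj_apply, inner_smul_right, inner_ind_ind, inner_ind_ind, Set.univ_inter,
    Set.inter_univ, Complex.ofReal_mul]

theorem Admissible.inner_ind_eval (R : Admissible) {A B : Set X} (hA : MeasurableSet A)
    (hB : MeasurableSet B) (T : MPAut μ) :
    inner ℂ (ind μ hB) (R.eval T (ind μ hA)) = (R.corr A B T : ℂ) := by
  have inner_tsum : inner ℂ (ind μ hB)
      ((∑' i : ℤ, (R.coeff i : ℂ) • koopman (T ^ i)) (ind μ hA)) =
        ∑' i : ℤ, ((R.coeff i * WeakLimits.corr A B (T ^ i) : ℝ) : ℂ) := by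
    refine ((innerSL ℂ (ind μ hB) ∘L ContinuousLinearMap.apply ℂ (L2 μ) (ind μ hA)).map_tsum
      (R.summable_eval T)).trans (tsum_congr fun i => ?_)
    simp [inner_ind_koopman]
  rw [Admissible.eval, _root_.add_apply, inner_add_right, _root_.smul_apply, inner_smul_right,
    inner_ind_meanProj, inner_tsum, ← Complex.ofReal_tsum, ← Complex.ofReal_mul,
    ← Complex.ofReal_add, Admissible.corr]

theorem ind_mem_topologicalClosure_span (D : DenseFamily μ) {A : Set X} (hA : MeasurableSet A) :
    ind μ hA ∈ (Submodule.span ℂ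
      (Set.range fun i => ind μ (D.measurableSet i))).topologicalClosure := by
  choose i hi using fun n : ℕ => D.dense A hA (1 / (n + 1)) Nat.one_div_pos_of_nat
  have tendsto_measure_symmDiff : Tendsto (fun n => μ (D.set (i n) ∆ A)) atTop (𝓝 0) := by
    rw [← ENNReal.tendsto_toReal_iff (fun _ => measure_ne_top _ _) ENNReal.zero_ne_top]
    exact squeeze_zero (fun _ => measureReal_nonneg) (fun n => (hi n).le)
      tendsto_one_div_add_atTop_nhds_zero_nat
  exact (Submodule.isClosed_topologicalClosure _).mem_of_tendsto
    (tendsto_indicatorConstLp_set (ht := fun n => D.measurableSet (i n))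
      (hμt := fun n => measure_ne_top _ _) (by norm_num) tendsto_measure_symmDiff)
    (Eventually.of_forall fun n =>
      Submodule.le_topologicalClosure _ (Submodule.subset_span (Set.mem_range_self (i n))))

theorem topologicalClosure_span_ind (D : DenseFamily μ) :
    (Submodule.span ℂ (Set.range fun i => ind μ (D.measurableSet i))).topologicalClosure = ⊤ := by
  refine eq_top_iff.2 fun f _ => ?_
  refine Lp.induction (by norm_num) (motive := (· ∈ Submodule.topologicalClosure _))
    (fun c A hA _ => ?_) (fun _ _ _ _ _ hf hg => Submodule.add_mem _ hf hg)
    (Submodule.isClosed_topologicalClosure _) f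
  rw [Lp.simpleFunc.coe_indicatorConst, indicatorConstLp_eq_smul_ind]
  exact Submodule.smul_mem _ c (ind_mem_topologicalClosure_span D hA)

theorem Admissible.weakLimitAlong_of_corr (R : Admissible) (D : DenseFamily μ) {M : Set ℕ}
    {T : MPAut μ} (h : ∀ i j, Tendsto (fun m : ℕ => WeakLimits.corr (D.set i) (D.set j) (T ^ m))
      (atTop ⊓ 𝓟 M) (𝓝 (R.corr (D.set i) (D.set j) T))) : WeakLimitAlong M T (R.eval T) := by
  rw [WeakLimitAlong, ContinuousLinearMapWOT.tendsto_iff_forall_inner_apply_tendsto]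
  refine tendsto_inner_apply_of_dense_span (V := fun m : ℕ => koopman (T ^ m))
    (fun m => norm_koopman_le _) (topologicalClosure_span_ind D) ?_
  rintro _ ⟨i, rfl⟩ _ ⟨j, rfl⟩
  simp only [inner_ind_koopman, R.inner_ind_eval]
  exact (Complex.continuous_ofReal.tendsto _).comp (h i j)

end Koopman

section Generic

theorem atTop_inf_principal_range_le_map (m : ℕ → ℕ) :
    atTop ⊓ 𝓟 (Set.range m) ≤ map m atTop := by
  rw [← Nat.cofinite_eq_atTop]
  intro s hs
  rw [mem_inf_principal, mem_cofinite]
  refine ((mem_cofinite.1 (mem_map.1 hs)).image m).subset fun a ha => ?_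
  simp only [Set.mem_compl_iff, Set.mem_ofPred_eq, Classical.not_imp] at ha
  obtain ⟨⟨n, rfl⟩, hn⟩ := ha
  exact Set.mem_image_of_mem m hn

variable {X : Type*} [MeasurableSpace X] {μ : Measure X}

theorem exists_finite_forall_abs_corr_sub_le_of_mem_nhds {T : MPAut μ} {V : Set (MPAut μ)}
    (hV : V ∈ 𝓝 T) : ∃ s : Set (Set X), s.Finite ∧ (∀ A ∈ s, MeasurableSet A) ∧
      ∃ ε > 0, ∀ U, (∀ A ∈ s, ∀ B ∈ s, |corr A B U - corr A B T| ≤ ε) → U ∈ V := by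
  rw [nhds_induced, nhds_pi, mem_comap] at hV
  obtain ⟨W, hW, hWV⟩ := hV
  obtain ⟨pairs, hpairs, t, ht, htW⟩ := Filter.mem_pi.1 hW
  have closedBall_subset : ∀ᶠ ε in 𝓝[>] (0 : ℝ), ∀ p ∈ pairs,
      Metric.closedBall (corr p.1.1 p.2.1 T) ε ⊆ t p := by
    refine (eventually_all_finite hpairs).2 fun p _ => ?_
    obtain ⟨δ, hδ, hδt⟩ := Metric.nhds_basis_closedBall.mem_iff.1 (ht p)
    filter_upwards [Ioo_mem_nhdsGT hδ] with ε hε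
      using (Metric.closedBall_subset_closedBall hε.2.le).trans hδt
  obtain ⟨ε, hεt, hε⟩ := (closedBall_subset.and self_mem_nhdsWithin).exists
  refine ⟨(fun p => p.1.1) '' pairs ∪ (fun p => p.2.1) '' pairs,
    (hpairs.image _).union (hpairs.image _), ?_, ε, hε, fun U hU => hWV (htW fun p hp => ?_)⟩
  · rintro A (⟨p, -, rfl⟩ | ⟨p, -, rfl⟩)
    exacts [p.1.2, p.2.2]
  · exact hεt p hp (hU _ (.inl (Set.mem_image_of_mem _ hp)) _ (.inr (Set.mem_image_of_mem _ hp)))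

variable [IsProbabilityMeasure μ] {κ : Type*}

/-- The transformations some power `Tᵐ` of which, with `m ∈ M`, has correlations on the sets `A k`
that are `ε`-close to those of `R(T)`. -/
def nearPowers (R : Admissible) (M : Set ℕ) (A : κ → Set X) (ε : ℝ) : Set (MPAut μ) :=
  {T | ∃ m ∈ M, ∀ k l, |corr (A k) (A l) (T ^ m) - R.corr (A k) (A l) T| < ε}

theorem exists_weakLimitAlong_of_forall_mem_nearPowers (D : DenseFamily μ) (R : Admissible)
    {M : Set ℕ} {T : MPAut μ} (hT : ∀ n : ℕ,
      T ∈ nearPowers R (M \ Set.Iio n) (fun i : Set.Iio n => D.set i) (1 / (n + 1))) :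
    ∃ M' ⊆ M, M'.Infinite ∧ WeakLimitAlong M' T (R.eval T) := by
  choose m hm hmT using hT
  refine ⟨Set.range m, Set.range_subset_iff.2 fun n => (hm n).1,
    Set.infinite_of_forall_exists_gt fun n =>
      ⟨m (n + 1), Set.mem_range_self _, Nat.lt_of_succ_le (not_lt.1 (hm (n + 1)).2)⟩,
    R.weakLimitAlong_of_corr D fun i j => ?_⟩
  refine Tendsto.mono_left (tendsto_map'_iff.2 ?_) (atTop_inf_principal_range_le_map m)
  refine tendsto_iff_dist_tendsto_zero.2 (squeeze_zero' (.of_forall fun _ => dist_nonneg) ?_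
    tendsto_one_div_add_atTop_nhds_zero_nat)
  filter_upwards [eventually_gt_atTop i, eventually_gt_atTop j] with n hi hj
    using (hmT n ⟨i, hi⟩ ⟨j, hj⟩).le

variable {A : κ → Set X} {ε : ℝ}

theorem isOpen_nearPowers [Finite κ] (R : Admissible) (M : Set ℕ)
    (hA : ∀ k, MeasurableSet (A k)) : IsOpen (nearPowers (μ := μ) R M A ε) := by
  have nearPowers_eq : nearPowers (μ := μ) R M A ε = ⋃ m ∈ M, ⋂ k, ⋂ l,
      {T | |corr (A k) (A l) (T ^ m) - R.corr (A k) (A l) T| < ε} := by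
    ext T
    simp [nearPowers]
  rw [nearPowers_eq]
  refine isOpen_biUnion fun m _ => isOpen_iInter_of_finite fun k => isOpen_iInter_of_finite
    fun l => isOpen_lt (((continuous_corr (hA k) (hA l)).comp (continuous_pow m)).sub
      (R.continuous_corr (hA k) (hA l))).abs continuous_const

variable [StandardBorelSpace X] [NullSingletonClass μ]

theorem dense_nearPowers [Finite κ] (R : Admissible) {M : Set ℕ} (hM : M.Infinite)
    (hA : ∀ k, MeasurableSet (A k)) (hε : 0 < ε) : Dense (nearPowers (μ := μ) R M A ε) := by
  intro T
  refine mem_closure_iff_nhds.2 fun V hV => ?_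
  have corr_near : ∀ᶠ U in 𝓝 T, ∀ k l, |R.corr (A k) (A l) T - R.corr (A k) (A l) U| < ε / 2 := by
    refine eventually_all.2 fun k => eventually_all.2 fun l => ?_
    filter_upwards [Metric.tendsto_nhds.1 ((R.continuous_corr (hA k) (hA l)).tendsto T) (ε / 2)
      (half_pos hε)] with U hU
    rwa [abs_sub_comm]
  obtain ⟨s, hs, hsm, δ, hδ, hsV⟩ :=
    exists_finite_forall_abs_corr_sub_le_of_mem_nhds (inter_mem hV corr_near)
  have := hs.to_subtype
  have measurableSet_family : ∀ k : κ ⊕ s, MeasurableSet (Sum.elim A (↑) k) := by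
    rintro (k | B)
    exacts [hA k, hsm B B.2]
  obtain ⟨m, ⟨U, hU⟩, hmM⟩ := ((R.eventually_exists_abs_corr_sub_le T measurableSet_family
    (lt_min hδ (half_pos hε))).and_frequently
      (Nat.frequently_atTop_iff_infinite.2 hM)).exists
  obtain ⟨hUV, hUR⟩ := hsV U fun A hA B hB =>
    (hU (.inr ⟨A, hA⟩) (.inr ⟨B, hB⟩)).1.trans (min_le_left _ _)
  refine ⟨U, hUV, m, hmM, fun k l => ?_⟩
  calc |corr (A k) (A l) (U ^ m) - R.corr (A k) (A l) U|
    _ ≤ |corr (A k) (A l) (U ^ m) - R.corr (A k) (A l) T| +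
        |R.corr (A k) (A l) T - R.corr (A k) (A l) U| := abs_sub_le _ _ _
    _ < ε / 2 + ε / 2 := add_lt_add_of_le_of_lt
        ((hU (.inl k) (.inl l)).2.trans (min_le_right _ _)) (hUR k l)
    _ = ε := add_halves ε

theorem eventually_residual_exists_weakLimitAlong (D : DenseFamily μ) (R : Admissible) {M : Set ℕ}
    (hM : M.Infinite) : ∀ᶠ T : MPAut μ in residual (MPAut μ),
      ∃ M' ⊆ M, M'.Infinite ∧ WeakLimitAlong M' T (R.eval T) := by
  have forall_mem_nearPowers : ∀ᶠ T : MPAut μ in residual (MPAut μ), ∀ n : ℕ,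
      T ∈ nearPowers R (M \ Set.Iio n) (fun i : Set.Iio n => D.set i) (1 / (n + 1)) :=
    eventually_countable_forall.2 fun n =>
      residual_of_dense_open (isOpen_nearPowers R _ fun i => D.measurableSet i)
        (dense_nearPowers R (hM.sdiff (Set.finite_Iio n)) (fun i => D.measurableSet i)
          Nat.one_div_pos_of_nat)
  exact forall_mem_nearPowers.mono fun T =>
    exists_weakLimitAlong_of_forall_mem_nearPowers D R

end Generic

section KappaMixing

/-- The admissible function `κ Θ + (1 - κ) I`. -/
def Admissible.kappa (κ : ℝ) (h0 : 0 ≤ κ) (h1 : κ ≤ 1) : Admissible where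
  a := κ
  coeff := Pi.single 0 (1 - κ)
  a_nonneg := h0
  coeff_nonneg i := by by_cases h : i = 0 <;> simp [h, h1]
  hasSum := hasSum_pi_single 0 (1 - κ)

variable {X : Type*} [MeasurableSpace X] {μ : Measure X} [IsProbabilityMeasure μ]

theorem Admissible.kappa_eval (κ : ℝ) (h0 : 0 ≤ κ) (h1 : κ ≤ 1) (T : MPAut μ) :
    (Admissible.kappa κ h0 h1).eval T =
      (κ : ℂ) • meanProj μ + ((1 - κ : ℝ) : ℂ) • ContinuousLinearMap.id ℂ (L2 μ) := by
  rw [Admissible.eval, tsum_eq_single 0, zpow_zero, koopman_one]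
  · simp [Admissible.kappa]
  · intro i hi
    simp [Admissible.kappa, Pi.single_eq_of_ne hi]

variable [StandardBorelSpace X] [NullSingletonClass μ]

theorem exists_measureReal_eq_half (μ : Measure X) [IsProbabilityMeasure μ]
    [NullSingletonClass μ] : ∃ A : Set X, MeasurableSet A ∧ μ.real A = 1 / 2 := by
  obtain ⟨Φ, -⟩ := exists_aeIso_uniformUnit (μ := μ) (c := 0) measurable_const
  refine ⟨Φ.toFun ⁻¹' Set.Iic (1 / 2),
    Φ.measurePreserving_toFun.measurable measurableSet_Iic, ?_⟩
  rw [Φ.measurePreserving_toFun.measureReal_preimage measurableSet_Iic.nullMeasurableSet,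
    uniformUnit, restrict_Ioo_eq_restrict_Ioc, measureReal_restrict_apply measurableSet_Iic,
    Set.inter_comm, Set.Ioc_inter_Iic, Real.volume_real_Ioc]
  norm_num

theorem meanProj_ne_id : meanProj μ ≠ ContinuousLinearMap.id ℂ (L2 μ) := by
  intro h
  obtain ⟨A, hA, measureReal_A⟩ := exists_measureReal_eq_half μ
  have inner_ind_A := inner_ind_meanProj (μ := μ) hA hA
  rw [h, ContinuousLinearMap.id_apply, inner_ind_ind, Set.inter_self, measureReal_A,
    Complex.ofReal_inj] at inner_ind_A
  norm_num at inner_ind_A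

theorem eventually_residual_exists_weakLimitAlong_kappa (D : DenseFamily μ) {κ : ℝ} (h0 : 0 ≤ κ)
    (h1 : κ ≤ 1) {M : Set ℕ} (hM : M.Infinite) : ∀ᶠ T : MPAut μ in residual (MPAut μ),
      ∃ M' ⊆ M, M'.Infinite ∧ WeakLimitAlong M' T
        ((κ : ℂ) • meanProj μ + ((1 - κ : ℝ) : ℂ) • ContinuousLinearMap.id ℂ (L2 μ)) := by
  simpa only [Admissible.kappa_eval] using
    eventually_residual_exists_weakLimitAlong D (Admissible.kappa κ h0 h1) hM

theorem eventually_residual_isKappaMixing (D : DenseFamily μ) {κ : ℝ} (h0 : 0 ≤ κ) (h1 : κ ≤ 1) :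
    ∀ᶠ T : MPAut μ in residual (MPAut μ), IsKappaMixing κ T :=
  (eventually_residual_exists_weakLimitAlong_kappa D h0 h1 Set.infinite_univ).mono
    fun _ ⟨M, _, hM, hT⟩ => ⟨M, hM, hT⟩

theorem eventually_residual_not_exists_weakLimitAlong (D : DenseFamily μ) {M : Set ℕ}
    (hM : M.Infinite) :
    ∀ᶠ T : MPAut μ in residual (MPAut μ), ¬∃ V, WeakLimitAlong M T V := by
  filter_upwards [eventually_residual_exists_weakLimitAlong_kappa D le_rfl zero_le_one hM,
    eventually_residual_exists_weakLimitAlong_kappa D zero_le_one le_rfl hM]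
  rintro T ⟨M₀, hM₀, infinite_M₀, limit_id⟩ ⟨M₁, hM₁, infinite_M₁, limit_meanProj⟩ ⟨V, hV⟩
  have V_eq_id := (hV.mono hM₀).unique infinite_M₀ limit_id
  have V_eq_meanProj := (hV.mono hM₁).unique infinite_M₁ limit_meanProj
  exact meanProj_ne_id (by simpa using V_eq_meanProj.symm.trans V_eq_id)

end KappaMixing

section AlmostOrthogonal

variable {𝕜 E : Type*} [RCLike 𝕜] [NormedAddCommGroup E] [InnerProductSpace 𝕜 E] {y : ℕ → E}

theorem exists_finset_card_eq_pairwise_norm_inner_le {M : Set ℕ} (hM : M.Infinite)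
    (h : ∀ k, Tendsto (fun m => inner 𝕜 (y m) (y k)) (atTop ⊓ 𝓟 M) (𝓝 0)) {δ : ℝ} (hδ : 0 < δ)
    (K : ℕ) : ∃ s : Finset ℕ, s.card = K ∧
      (s : Set ℕ).Pairwise fun k l => ‖inner 𝕜 (y k) (y l)‖ ≤ δ := by
  induction K with
  | zero => exact ⟨∅, rfl, by simp⟩
  | succ K ih =>
    obtain ⟨s, card_s, pairwise_s⟩ := ih
    have : (atTop ⊓ 𝓟 M : Filter ℕ).NeBot :=
      frequently_mem_iff_neBot.1 (Nat.frequently_atTop_iff_infinite.2 hM)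
    have inner_small : ∀ᶠ m in atTop ⊓ 𝓟 M, ∀ k ∈ s, ‖inner 𝕜 (y m) (y k)‖ ≤ δ :=
      (eventually_all_finset _).2 fun k _ =>
        ((h k).norm.eventually_lt_const (by rwa [norm_zero])).mono fun _ => le_of_lt
    have notMem : ∀ᶠ m in atTop ⊓ 𝓟 M, m ∉ s :=
      (Nat.cofinite_eq_atTop ▸ s.eventually_cofinite_notMem).filter_mono inf_le_left
    obtain ⟨m, hm, hms⟩ := (inner_small.and notMem).exists
    refine ⟨insert m s, by rw [Finset.card_insert_of_notMem hms, card_s], ?_⟩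
    rw [Finset.coe_insert]
    exact pairwise_s.insert fun k hk _ => ⟨hm k hk, norm_inner_symm (𝕜 := 𝕜) (y k) (y m) ▸ hm k hk⟩

theorem sum_norm_inner_sq_le {ι : Type*} (s : Finset ι) (x : E) (y : ι → E) :
    (∑ k ∈ s, ‖inner 𝕜 x (y k)‖) ^ 2 ≤
      ‖x‖ ^ 2 * ∑ k ∈ s, ∑ l ∈ s, ‖inner 𝕜 (y k) (y l)‖ := by
  choose c norm_c hc using fun k => RCLike.exists_norm_eq_mul_self (inner 𝕜 x (y k))
  let v := ∑ k ∈ s, c k • y k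
  have inner_v : inner 𝕜 x v = ((∑ k ∈ s, ‖inner 𝕜 x (y k)‖ : ℝ) : 𝕜) := by
    simp only [v, inner_sum, inner_smul_right, ← hc, RCLike.ofReal_sum]
  have norm_v_sq_le : ‖v‖ ^ 2 ≤ ∑ k ∈ s, ∑ l ∈ s, ‖inner 𝕜 (y k) (y l)‖ := calc
    ‖v‖ ^ 2 = ‖∑ k ∈ s, ∑ l ∈ s, inner 𝕜 (c k • y k) (c l • y l)‖ := by
      simp only [← inner_sum, ← sum_inner]
      rw [inner_self_eq_norm_sq_to_K, norm_pow, RCLike.norm_ofReal, abs_norm]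
    _ ≤ ∑ k ∈ s, ∑ l ∈ s, ‖inner 𝕜 (y k) (y l)‖ := by
      refine norm_sum_le_of_le _ fun k _ => norm_sum_le_of_le _ fun l _ => le_of_eq ?_
      rw [inner_smul_left, inner_smul_right, norm_mul, norm_mul, RCLike.norm_conj, norm_c, norm_c,
        one_mul, one_mul]
  calc (∑ k ∈ s, ‖inner 𝕜 x (y k)‖) ^ 2
    _ = ‖inner 𝕜 x v‖ ^ 2 := by rw [inner_v, RCLike.norm_ofReal, sq_abs]
    _ ≤ (‖x‖ * ‖v‖) ^ 2 := by gcongr; exact norm_inner_le_norm x v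
    _ ≤ ‖x‖ ^ 2 * ∑ k ∈ s, ∑ l ∈ s, ‖inner 𝕜 (y k) (y l)‖ := by rw [mul_pow]; gcongr

theorem sum_sum_norm_inner_le {ι : Type*} {s : Finset ι} {y : ι → E} {G δ : ℝ} (hδ : 0 ≤ δ)
    (hG : ∀ k, ‖y k‖ ≤ G) (hs : (s : Set ι).Pairwise fun k l => ‖inner 𝕜 (y k) (y l)‖ ≤ δ) :
    ∑ k ∈ s, ∑ l ∈ s, ‖inner 𝕜 (y k) (y l)‖ ≤ s.card * (G ^ 2 + s.card * δ) := by
  classical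
  rw [← nsmul_eq_mul]
  refine Finset.sum_le_card_nsmul _ _ _ fun k hk => ?_
  rw [← Finset.add_sum_erase s _ hk]
  gcongr
  · calc ‖inner 𝕜 (y k) (y k)‖ ≤ ‖y k‖ * ‖y k‖ := norm_inner_le_norm _ _
      _ ≤ G ^ 2 := by rw [← sq]; gcongr; exact hG k
  · calc ∑ l ∈ s.erase k, ‖inner 𝕜 (y k) (y l)‖ ≤ (s.erase k).card • δ :=
        Finset.sum_le_card_nsmul _ _ _ fun l hl =>
          hs hk (Finset.mem_of_mem_erase hl) (Finset.ne_of_mem_erase hl).symm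
      _ ≤ s.card * δ := by
        rw [nsmul_eq_mul]
        gcongr
        exact Finset.erase_subset k s

theorem exists_finset_nonempty_sum_norm_inner_le {x : ℕ → E} {F G : ℝ} (hx : ∀ n, ‖x n‖ ≤ F)
    (hy : ∀ k, ‖y k‖ ≤ G) {M : Set ℕ} (hM : M.Infinite)
    (h : ∀ k, Tendsto (fun m => inner 𝕜 (y m) (y k)) (atTop ⊓ 𝓟 M) (𝓝 0)) {ε : ℝ} (hε : 0 < ε) :
    ∃ s : Finset ℕ, s.Nonempty ∧ ∀ n, ∑ k ∈ s, ‖inner 𝕜 (x n) (y k)‖ ≤ s.card * ε := by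
  have card_large : Tendsto (fun K : ℕ => F ^ 2 * (G ^ 2 * (K : ℝ)⁻¹ + (K : ℝ)⁻¹)) atTop (𝓝 0) := by
    simpa using ((tendsto_inv_atTop_nhds_zero_nat (𝕜 := ℝ)).const_mul (G ^ 2)).add
      tendsto_inv_atTop_nhds_zero_nat |>.const_mul (F ^ 2)
  obtain ⟨K, hK, K_pos⟩ := ((card_large.eventually_lt_const (sq_pos_of_pos hε)).and
    (eventually_gt_atTop 0)).exists
  have K_cast_pos : (0 : ℝ) < K := Nat.cast_pos.2 K_pos
  obtain ⟨s, card_s, pairwise_s⟩ :=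
    exists_finset_card_eq_pairwise_norm_inner_le hM h (inv_pos.2 K_cast_pos) K
  refine ⟨s, Finset.card_pos.1 (card_s ▸ K_pos), fun n => ?_⟩
  refine (sq_le_sq₀ (Finset.sum_nonneg fun _ _ => norm_nonneg _) (by positivity)).1 ?_
  calc (∑ k ∈ s, ‖inner 𝕜 (x n) (y k)‖) ^ 2
    _ ≤ ‖x n‖ ^ 2 * ∑ k ∈ s, ∑ l ∈ s, ‖inner 𝕜 (y k) (y l)‖ := sum_norm_inner_sq_le s _ _
    _ ≤ F ^ 2 * (K * (G ^ 2 + K * (K : ℝ)⁻¹)) := by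
      gcongr
      · exact hx n
      · simpa only [card_s] using sum_sum_norm_inner_le (by positivity) hy pairwise_s
    _ = K ^ 2 * (F ^ 2 * (G ^ 2 * (K : ℝ)⁻¹ + (K : ℝ)⁻¹)) := by
      field_simp
    _ ≤ (s.card * ε) ^ 2 := by
      rw [card_s, mul_pow]
      gcongr

end AlmostOrthogonal

section CesaroMeans

theorem sum_range_le_sum_range_add {a : ℕ → ℝ} {C : ℝ} (ha : ∀ n, 0 ≤ a n) (haC : ∀ n, a n ≤ C)
    (N k : ℕ) : ∑ n ∈ Finset.range N, a n ≤ ∑ n ∈ Finset.range N, a (n + k) + k * C := calc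
  ∑ n ∈ Finset.range N, a n ≤ ∑ n ∈ Finset.range (k + N), a n :=
    Finset.sum_le_sum_of_subset_of_nonneg (Finset.range_mono (by lia)) fun n _ _ => ha n
  _ = ∑ n ∈ Finset.range N, a (n + k) + ∑ n ∈ Finset.range k, a n := by
    rw [Finset.sum_range_add, add_comm]
    simp only [add_comm k]
  _ ≤ ∑ n ∈ Finset.range N, a (n + k) + k * C := by
    gcongr
    simpa using Finset.sum_le_card_nsmul (Finset.range k) a C fun n _ => haC n

theorem tendsto_average_zero_of_exists_finset_sum_shift_le {a : ℕ → ℝ} {C : ℝ} (ha : ∀ n, 0 ≤ a n)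
    (haC : ∀ n, a n ≤ C)
    (h : ∀ ε > 0, ∃ s : Finset ℕ, s.Nonempty ∧ ∀ n, ∑ k ∈ s, a (n + k) ≤ s.card * ε) :
    Tendsto (fun N : ℕ => (N : ℝ)⁻¹ * ∑ n ∈ Finset.range N, a n) atTop (𝓝 0) := by
  refine Metric.tendsto_nhds.2 fun ε hε => ?_
  obtain ⟨s, hs, sum_shift_le⟩ := h (ε / 2) (half_pos hε)
  have card_pos : (0 : ℝ) < s.card := Nat.cast_pos.2 hs.card_pos
  let L : ℝ := ∑ k ∈ s, k * C
  have card_mul_sum_le (N : ℕ) :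
      s.card * ∑ n ∈ Finset.range N, a n ≤ N * (s.card * (ε / 2)) + L := calc
    s.card * ∑ n ∈ Finset.range N, a n
      ≤ ∑ k ∈ s, (∑ n ∈ Finset.range N, a (n + k) + k * C) := by
        simpa using Finset.card_nsmul_le_sum s _ _ fun k _ => sum_range_le_sum_range_add ha haC N k
    _ = ∑ n ∈ Finset.range N, ∑ k ∈ s, a (n + k) + L := by
        rw [Finset.sum_add_distrib, Finset.sum_comm]
    _ ≤ N * (s.card * (ε / 2)) + L := by
        gcongr
        simpa using Finset.sum_le_card_nsmul (Finset.range N) _ _ fun n _ => sum_shift_le n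
  have remainder_small : Tendsto (fun N : ℕ => L / s.card * (N : ℝ)⁻¹) atTop (𝓝 0) := by
    simpa using tendsto_inv_atTop_nhds_zero_nat.const_mul (L / s.card)
  filter_upwards [remainder_small.eventually_lt_const (half_pos hε), eventually_gt_atTop 0]
    with N hN N_pos
  have average_nonneg : 0 ≤ (N : ℝ)⁻¹ * ∑ n ∈ Finset.range N, a n :=
    mul_nonneg (by positivity) (Finset.sum_nonneg fun n _ => ha n)
  rw [Real.dist_0_eq_abs, abs_of_nonneg average_nonneg]
  calc (N : ℝ)⁻¹ * ∑ n ∈ Finset.range N, a n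
    _ ≤ (N : ℝ)⁻¹ * ((N * (s.card * (ε / 2)) + L) / s.card) := by
      gcongr
      exact (le_div_iff₀' card_pos).2 (card_mul_sum_le N)
    _ = ε / 2 + L / s.card * (N : ℝ)⁻¹ := by field_simp
    _ < ε := by linarith

end CesaroMeans

section WeakMixing

variable {X : Type*} [MeasurableSpace X] {μ : Measure X}

theorem inner_koopman_left (T : MPAut μ) (f g : L2 μ) :
    inner ℂ (koopman T f) g = inner ℂ f (koopman T⁻¹ g) := by
  rw [← inner_koopman_koopman T f, ← koopman_mul_apply, inv_mul_cancel, koopman_one,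
    ContinuousLinearMap.id_apply]

variable [IsProbabilityMeasure μ]

theorem inner_koopman_meanProj (T : MPAut μ) (f g : L2 μ) :
    inner ℂ (koopman T f) (meanProj μ g) = inner ℂ (meanProj μ f) g := by
  rw [meanProj_apply, meanProj_apply, inner_smul_right, inner_smul_left, inner_koopman_left,
    koopman_ind_univ, inner_conj_symm, mul_comm]

theorem isWeakMixing_of_weakLimitAlong_meanProj {T : MPAut μ} {M : Set ℕ} (hM : M.Infinite)
    (hT : WeakLimitAlong M T (meanProj μ)) : IsWeakMixing T := by
  intro f g
  let g₀ := g - meanProj μ g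
  have meanProj_g₀ : meanProj μ g₀ = 0 := by
    rw [map_sub, sub_eq_zero]
    exact (DFunLike.congr_fun (Submodule.isIdempotentElem_starProjection _) g).symm
  have inner_shift (n k : ℕ) : inner ℂ (koopman (T ^ (n + k)) f) g₀ =
      inner ℂ (koopman (T ^ n) f) (koopman (T ^ k)⁻¹ g₀) := by
    rw [pow_add, koopman_mul_apply, inner_koopman_left]
  have tendsto_inner (k : ℕ) : Tendsto
      (fun m : ℕ => inner ℂ (koopman (T ^ m)⁻¹ g₀) (koopman (T ^ k)⁻¹ g₀)) (atTop ⊓ 𝓟 M)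
      (𝓝 0) := by
    have hk := ContinuousLinearMapWOT.tendsto_iff_forall_inner_apply_tendsto.1 hT g₀
      (koopman (T ^ k) g₀)
    rw [ContinuousLinearMapWOT.ofCLM_apply, meanProj_g₀, inner_zero_right] at hk
    refine hk.congr fun m => Eq.symm ?_
    calc inner ℂ (koopman (T ^ m)⁻¹ g₀) (koopman (T ^ k)⁻¹ g₀)
      _ = inner ℂ (koopman ((T ^ m)⁻¹ * T ^ k) g₀) g₀ := by
        rw [← inner_koopman_left, koopman_mul_apply]
      _ = inner ℂ (koopman (T ^ k * (T ^ m)⁻¹) g₀) g₀ := by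
        rw [(Commute.pow_pow_self T k m).inv_right.eq]
      _ = inner ℂ (koopman (T ^ k) g₀) (koopman (T ^ m) g₀) := by
        rw [koopman_mul_apply, inner_koopman_left, inv_inv]
  have average_tendsto : Tendsto (fun N : ℕ => (N : ℝ)⁻¹ *
      ∑ n ∈ Finset.range N, ‖inner ℂ (koopman (T ^ n) f) g₀‖) atTop (𝓝 0) := by
    refine tendsto_average_zero_of_exists_finset_sum_shift_le (C := ‖f‖ * ‖g₀‖)
      (fun _ => norm_nonneg _)
      (fun n => norm_koopman_apply (T ^ n) f ▸ norm_inner_le_norm _ _) fun ε hε => ?_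
    simp only [inner_shift]
    exact exists_finset_nonempty_sum_norm_inner_le (fun n => (norm_koopman_apply _ f).le)
      (fun k => (norm_koopman_apply _ g₀).le) hM tendsto_inner hε
  simpa only [g₀, inner_sub_right, inner_koopman_meanProj] using average_tendsto

theorem eventually_residual_isWeakMixing [StandardBorelSpace X] [NullSingletonClass μ]
    (D : DenseFamily μ) : ∀ᶠ T : MPAut μ in residual (MPAut μ), IsWeakMixing T := by
  filter_upwards [eventually_residual_exists_weakLimitAlong_kappa D zero_le_one le_rfl
    Set.infinite_univ]
  rintro T ⟨M, -, hM, hT⟩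
  exact isWeakMixing_of_weakLimitAlong_meanProj hM (by simpa using hT)

end WeakMixing

end WeakLimits

end

theorem mainTheorem6_general {X : Type*} [MeasurableSpace X] [StandardBorelSpace X]
    (μ : Measure X) [IsProbabilityMeasure μ] [NullSingletonClass μ] (D : WeakLimits.DenseFamily μ) :
    (∀ M : Set ℕ, M.Infinite →
      (∀ R : WeakLimits.Admissible, WeakLimits.IsGeneric D
        {T : WeakLimits.MPAut μ | ∃ M' ⊆ M, M'.Infinite ∧
          WeakLimits.WeakLimitAlong M' T (R.eval T)}) ∧
      WeakLimits.IsFirstCategory D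
        {T : WeakLimits.MPAut μ | ∃ V, WeakLimits.WeakLimitAlong M T V}) ∧
    WeakLimits.IsGeneric D {T : WeakLimits.MPAut μ | WeakLimits.IsWeakMixing T} ∧
    WeakLimits.IsGeneric D {T : WeakLimits.MPAut μ | ¬ WeakLimits.IsMixing T} ∧
    (∀ κ : ℝ, 0 ≤ κ → κ ≤ 1 →
      WeakLimits.IsGeneric D {T : WeakLimits.MPAut μ | WeakLimits.IsKappaMixing κ T}) := by
  open WeakLimits in
  simp only [isGeneric_iff_mem_residual, isFirstCategory_iff_isMeagre]
  exact ⟨fun M hM => ⟨fun R => eventually_residual_exists_weakLimitAlong D R hM,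
      eventually_residual_not_exists_weakLimitAlong D hM⟩,
    eventually_residual_isWeakMixing D,
    (eventually_residual_not_exists_weakLimitAlong D Set.infinite_univ).mono
      fun T hT hmixing => hT ⟨_, hmixing⟩,
    fun κ h0 h1 => eventually_residual_isKappaMixing D h0 h1⟩

theorem mainTheorem6 {X : Type*} [MeasurableSpace X] [StandardBorelSpace X]
    (μ : Measure X) [IsProbabilityMeasure μ] [NullSingletonClass μ] (D : WeakLimits.DenseFamily μ) :
    (∀ M : Set ℕ, M.Infinite → ∀ Q R : WeakLimits.Admissible,
      WeakLimits.IsGeneric D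
        {T : WeakLimits.MPAut μ | ∃ M' ⊆ M, M'.Infinite ∧
          WeakLimits.WeakLimitAlong M' T (R.eval T)} ∧
      WeakLimits.IsFirstCategory D
        {T : WeakLimits.MPAut μ | WeakLimits.WeakLimitAlong M T (Q.eval T)}) ∧
    WeakLimits.IsGeneric D {T : WeakLimits.MPAut μ | WeakLimits.IsWeakMixing T} ∧
    WeakLimits.IsGeneric D {T : WeakLimits.MPAut μ | ¬ WeakLimits.IsMixing T} ∧
    (∀ κ : ℝ, 0 ≤ κ → κ ≤ 1 →
      WeakLimits.IsGeneric D {T : WeakLimits.MPAut μ | WeakLimits.IsKappaMixing κ T}) := by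
  obtain ⟨limits, consequences⟩ := mainTheorem6_general μ D
  exact ⟨fun M hM Q R => ⟨(limits M hM).1 R,
    (limits M hM).2.mono fun _ hT => ⟨Q.eval _, hT⟩⟩, consequences⟩
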